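/- Let $\Lambda\subset\mathbb C$ be a lattice and $E=\mathbb C/\Lambda$ the corresponding elliptic curve. For integers $a,b,c\ge 0$ let $L(a,b,c)$ denote the complex vector space of all meromorphic functions on $E\times E$ that are holomorphic outside the three curves $\{0\}\times E$, $E\times\{0\}$ and the diagonal, and that have along these curves poles of order at most $a$, $b$, $c$ respectively. Let $\wp$ be the Weierstrass function of $\Lambda$, and let $M(4a,4b,4c)$ be the complex vector space spanned by all functions of $(z,w)\in E\times E$ that are products of $a$ (not necessarily distinct) elements of $\{1,\wp(z),\wp'(z),\wp''(z)\}$, $b$ elements of $\{1,\wp(w),\wp'(w),\wp''(w)\}$ and $c$ elements of $\{1,\wp(z-w),\wp'(z-w),\wp''(z-w)\}$. Then for all integers $a,b,c\ge0$ the multiplication map $$L(4,0,0)^{\otimes a}\otimes_{\mathbb C} L(0,4,0)^{\otimes b}\otimes_{\mathbb C} L(0,0,4)^{\otimes c}\longrightarrow L(4a,4b,4c)$$ is surjective, and moreover $L(4a,4b,4c)=M(4a,4b,4c)$. -/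

import Mathlib

open Filter
open scoped Topology TensorProduct

noncomputable section

namespace EllipticSquare

/-- The elliptic curve `E = ℂ / Λ`, where `Λ` is the lattice spanned by a pair of periods. -/
abbrev Curve (P : PeriodPair) : Type := ℂ ⧸ P.lattice

/-- The projection `ℂ → E`. -/
abbrev proj (P : PeriodPair) (z : ℂ) : Curve P := Submodule.Quotient.mk z

/-- The complement in `E × E` of the three curves `{0} × E`, `E × {0}` and the diagonal. -/
def regularLocus (P : PeriodPair) : Set (Curve P × Curve P) :=
  {x | x.1 ≠ 0 ∧ x.2 ≠ 0 ∧ x.1 ≠ x.2}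

open Classical in
/-- The local equation, near `z₀`, of the lattice `Λ ⊆ ℂ` as a reduced divisor:
`z ↦ z - z₀` if `z₀ ∈ Λ`, and the unit `1` if `z₀ ∉ Λ`. -/
def localEq (P : PeriodPair) (z₀ z : ℂ) : ℂ := if z₀ ∈ P.lattice then z - z₀ else 1

/-- The local equation, near the image of `p = (z₀, w₀)` and in the coordinates `q = (z, w)`, of
the divisor `a ({0} × E) + b (E × {0}) + c Δ` on `E × E`, where `Δ` is the diagonal. -/
def divisorEq (P : PeriodPair) (a b c : ℕ) (p q : ℂ × ℂ) : ℂ :=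
  localEq P p.1 q.1 ^ a * localEq P p.2 q.2 ^ b * localEq P (p.1 - p.2) (q.1 - q.2) ^ c

/-- `f` has at worst poles of order `≤ a`, `≤ b`, `≤ c` along `{0} × E`, `E × {0}` and the
diagonal, and no other poles: near each point of `E × E`, in the coordinates given by
`ℂ × ℂ → E × E`, the product of `f` and the local equation of the divisor
`a ({0} × E) + b (E × {0}) + c Δ` extends to a holomorphic function of two variables. -/
def HasPolesLE (P : PeriodPair) (a b c : ℕ) (f : regularLocus P → ℂ) : Prop :=
  ∀ p : ℂ × ℂ, ∃ g : ℂ × ℂ → ℂ, AnalyticAt ℂ g p ∧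
    ∀ᶠ q in 𝓝 p, ∀ hq : (proj P q.1, proj P q.2) ∈ regularLocus P,
      f ⟨(proj P q.1, proj P q.2), hq⟩ * divisorEq P a b c p q = g q

theorem divisorEq_add (P : PeriodPair) (a b c a' b' c' : ℕ) (p q : ℂ × ℂ) :
    divisorEq P (a + a') (b + b') (c + c') p q
      = divisorEq P a b c p q * divisorEq P a' b' c' p q := by
  simp only [divisorEq, pow_add]; ring

theorem HasPolesLE.mul {P : PeriodPair} {a b c a' b' c' : ℕ} {f f' : regularLocus P → ℂ}
    (hf : HasPolesLE P a b c f) (hf' : HasPolesLE P a' b' c' f') :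
    HasPolesLE P (a + a') (b + b') (c + c') (f * f') := by
  intro p
  obtain ⟨g, hg, h⟩ := hf p
  obtain ⟨g', hg', h'⟩ := hf' p
  refine ⟨g * g', hg.mul hg', ?_⟩
  filter_upwards [h, h'] with q hq hq' hm
  rw [Pi.mul_apply, Pi.mul_apply, ← hq hm, ← hq' hm, divisorEq_add]
  ring

theorem HasPolesLE.one (P : PeriodPair) : HasPolesLE P 0 0 0 1 := fun _ =>
  ⟨1, analyticAt_const, Eventually.of_forall fun _ _ => by simp [divisorEq]⟩

/-- The space `L(a, b, c)` of meromorphic functions on `E × E` which are regular or have poles of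
order `≤ a`, `≤ b`, `≤ c` along `{0} × E`, `E × {0}` and the diagonal. Such a function is
represented by its restriction to the complement of the three curves, which determines it. -/
def poleSpace (P : PeriodPair) (a b c : ℕ) : Submodule ℂ (regularLocus P → ℂ) where
  carrier := {f | HasPolesLE P a b c f}
  zero_mem' := fun _ => ⟨0, analyticAt_const, Eventually.of_forall fun _ _ => by simp⟩
  add_mem' := by
    intro f f' hf hf' p
    obtain ⟨g, hg, h⟩ := hf p
    obtain ⟨g', hg', h'⟩ := hf' p
    refine ⟨g + g', hg.add hg', ?_⟩
    filter_upwards [h, h'] with q hq hq' hm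
    rw [Pi.add_apply, Pi.add_apply, ← hq hm, ← hq' hm]
    ring
  smul_mem' := by
    intro r f hf p
    obtain ⟨g, hg, h⟩ := hf p
    refine ⟨fun q => r * g q, analyticAt_const.mul hg, ?_⟩
    filter_upwards [h] with q hq hm
    rw [Pi.smul_apply, smul_eq_mul, ← hq hm]
    ring

/-- The multiplication map `V ^{⊗ n} → A` for a subspace `V` of a commutative algebra `A`. -/
def powMul {A : Type*} [CommRing A] [Algebra ℂ A] (V : Submodule ℂ A) (n : ℕ) :
    (⨂[ℂ]^n V) →ₗ[ℂ] A :=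
  PiTensorProduct.lift
    ((MultilinearMap.mkPiAlgebra ℂ (Fin n) A).compLinearMap fun _ => V.subtype)

theorem powMul_tprod {A : Type*} [CommRing A] [Algebra ℂ A] (V : Submodule ℂ A) (n : ℕ)
    (v : Fin n → V) : powMul V n (PiTensorProduct.tprod ℂ v) = ∏ i, (v i : A) := by
  simp [powMul]

/-- The multiplication map `L(4,0,0)^{⊗ a} ⊗ L(0,4,0)^{⊗ b} ⊗ L(0,0,4)^{⊗ c} → A`, where `A` is
the algebra of all functions on the complement of the three curves. -/
def mulMapAux (P : PeriodPair) (a b c : ℕ) :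
    ((⨂[ℂ]^a (poleSpace P 4 0 0)) ⊗[ℂ] (⨂[ℂ]^b (poleSpace P 0 4 0))) ⊗[ℂ]
      (⨂[ℂ]^c (poleSpace P 0 0 4)) →ₗ[ℂ] (regularLocus P → ℂ) :=
  LinearMap.mul' ℂ (regularLocus P → ℂ) ∘ₗ
    TensorProduct.map
      (LinearMap.mul' ℂ (regularLocus P → ℂ) ∘ₗ
        TensorProduct.map (powMul (poleSpace P 4 0 0) a) (powMul (poleSpace P 0 4 0) b))
      (powMul (poleSpace P 0 0 4) c)

theorem HasPolesLE.prod {P : PeriodPair} {a b c : ℕ} (n : ℕ) (f : Fin n → regularLocus P → ℂ)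
    (hf : ∀ i, HasPolesLE P a b c (f i)) :
    HasPolesLE P (a * n) (b * n) (c * n) (∏ i, f i) := by
  induction n with
  | zero => simpa using HasPolesLE.one P
  | succ n ih =>
    rw [Fin.prod_univ_castSucc, Nat.mul_succ, Nat.mul_succ, Nat.mul_succ]
    exact (ih _ fun i => hf _).mul (hf _)

theorem powMul_mem {P : PeriodPair} {a b c : ℕ} (n : ℕ) (t : ⨂[ℂ]^n (poleSpace P a b c)) :
    powMul (poleSpace P a b c) n t ∈ poleSpace P (a * n) (b * n) (c * n) := by
  induction t using PiTensorProduct.induction_on with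
  | smul_tprod r v =>
    rw [map_smul, powMul_tprod]
    exact Submodule.smul_mem _ _ (HasPolesLE.prod n _ fun i => (v i).2)
  | add x y hx hy => rw [map_add]; exact Submodule.add_mem _ hx hy

theorem mulMapAux_mem (P : PeriodPair) (a b c : ℕ)
    (t : ((⨂[ℂ]^a (poleSpace P 4 0 0)) ⊗[ℂ] (⨂[ℂ]^b (poleSpace P 0 4 0))) ⊗[ℂ]
      (⨂[ℂ]^c (poleSpace P 0 0 4))) :
    mulMapAux P a b c t ∈ poleSpace P (4 * a) (4 * b) (4 * c) := by
  induction t using TensorProduct.induction_on with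
  | zero => rw [map_zero]; exact Submodule.zero_mem _
  | add x y hx hy => rw [map_add]; exact Submodule.add_mem _ hx hy
  | tmul s u =>
    induction s using TensorProduct.induction_on with
    | zero => rw [TensorProduct.zero_tmul, map_zero]; exact Submodule.zero_mem _
    | add x y hx hy =>
      rw [TensorProduct.add_tmul, map_add]; exact Submodule.add_mem _ hx hy
    | tmul s t =>
      have h : HasPolesLE P _ _ _ _ := HasPolesLE.mul
        (HasPolesLE.mul (powMul_mem a s) (powMul_mem b t)) (powMul_mem c u)
      simp only [zero_mul, zero_add, add_zero] at h
      exact h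

/-- The multiplication map
`L(4,0,0)^{⊗ a} ⊗ L(0,4,0)^{⊗ b} ⊗ L(0,0,4)^{⊗ c} → L(4a,4b,4c)`. -/
def mulMap (P : PeriodPair) (a b c : ℕ) :
    ((⨂[ℂ]^a (poleSpace P 4 0 0)) ⊗[ℂ] (⨂[ℂ]^b (poleSpace P 0 4 0))) ⊗[ℂ]
      (⨂[ℂ]^c (poleSpace P 0 0 4)) →ₗ[ℂ] poleSpace P (4 * a) (4 * b) (4 * c) :=
  (mulMapAux P a b c).codRestrict _ (mulMapAux_mem P a b c)

/-- The map on pure tensors is the product of all the factors. -/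
theorem mulMap_tprod (P : PeriodPair) (a b c : ℕ) (f : Fin a → poleSpace P 4 0 0)
    (g : Fin b → poleSpace P 0 4 0) (h : Fin c → poleSpace P 0 0 4) :
    (mulMap P a b c ((PiTensorProduct.tprod ℂ f ⊗ₜ[ℂ] PiTensorProduct.tprod ℂ g) ⊗ₜ[ℂ]
      PiTensorProduct.tprod ℂ h) : regularLocus P → ℂ)
      = (∏ i, (f i : regularLocus P → ℂ)) * (∏ i, (g i : regularLocus P → ℂ)) *
        ∏ i, (h i : regularLocus P → ℂ) := by
  simp [mulMap, mulMapAux, powMul_tprod]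

/-- A `Λ`-periodic function on `ℂ` as a function on `E = ℂ / Λ`. -/
def descend (P : PeriodPair) (f : ℂ → ℂ) (hf : ∀ l : P.lattice, Function.Periodic f l) :
    Curve P → ℂ :=
  Quotient.lift f fun x y hxy => by
    have h : x - y ∈ P.lattice := (Submodule.quotientRel_def P.lattice).1 hxy
    have := hf ⟨x - y, h⟩ y
    simpa using this

theorem periodic_deriv (P : PeriodPair) (f : ℂ → ℂ)
    (hf : ∀ l : P.lattice, Function.Periodic f l) (l : P.lattice) :
    Function.Periodic (deriv f) l := fun x => by
  rw [← deriv_comp_add_const, funext (hf l)]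

/-- The four functions `1, ℘, ℘', ℘''` on `E`. -/
def row (P : PeriodPair) : Fin 4 → Curve P → ℂ :=
  ![1,
    descend P P.weierstrassP P.periodic_weierstrassP,
    descend P P.derivWeierstrassP P.periodic_derivWeierstrassP,
    descend P (deriv P.derivWeierstrassP) (periodic_deriv P _ P.periodic_derivWeierstrassP)]

/-- The product of `a` entries of the row `1, ℘(z), ℘'(z), ℘''(z)`, `b` entries of the row
`1, ℘(w), ℘'(w), ℘''(w)` and `c` entries of the row `1, ℘(z-w), ℘'(z-w), ℘''(z-w)`
(repetitions allowed), as a function of `(z, w)`. -/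
def weierstrassProduct (P : PeriodPair) {a b c : ℕ} (i : Fin a → Fin 4) (j : Fin b → Fin 4)
    (k : Fin c → Fin 4) : regularLocus P → ℂ := fun x =>
  (∏ r, row P (i r) x.1.1) * (∏ r, row P (j r) x.1.2) * ∏ r, row P (k r) (x.1.1 - x.1.2)

/-- The space `M(4a, 4b, 4c)` spanned by these products. -/
def weierstrassSpan (P : PeriodPair) (a b c : ℕ) : Submodule ℂ (regularLocus P → ℂ) :=
  Submodule.span ℂ {f | ∃ (i : Fin a → Fin 4) (j : Fin b → Fin 4) (k : Fin c → Fin 4),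
    f = weierstrassProduct P i j k}

end EllipticSquare

end

/-!
Functions on `E × E` are studied through their expansion along the curve `{0} × E`. If `f` lies in
`L(k, B, C)`, the coefficient of `z⁻ᵏ` in `f(z, w)` is an elliptic function `h(w)`, and it has a
pole of order at most `B + C`, because `E × {0}` and the diagonal meet `{0} × E` only in the origin
(`HasPolesLE.exists_leadingCoeff`). If `h = 0` and `k > 0`, then `f` lies in `L(k - 1, B, C)`
(`HasPolesLE.of_leadingCoeff_zero`): an analytic function of two variables that vanishes on a
coordinate line is divisible by the coordinate. So `L(4a, 4b, 4c) ⊆ M(4a, 4b, 4c)` follows by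
induction on the order `k` of the pole, once every possible `h` is the coefficient of `z⁻ᵏ` of an
element of `M(4a, 4b, 4c)`.

In one variable, the elliptic functions with a pole of order at most `4n` at the origin are spanned
by the products of `n` of the functions `1, ℘, ℘', ℘''` (`PoleLE.exists_mem_productSpan`): such
products attain every pole order up to `4n` except `1`, and no elliptic function has a single simple
pole (`PoleLE.exists_eq_const`). For `k ≠ 1` the required functions are therefore
`ρ(z) φ(w) ψ(z - w)`, with `ρ` a product with a pole of order exactly `k`.

For `k = 1` and `b, c ≥ 1` it suffices to treat `a = b = c = 1`
(`mul_rowFun_mem_leadingSpace`). The expressions `φ(w) ψ(w - z) - ψ(w) φ(w - z)` vanish to first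
order along `{0} × E`, and multiplying them by `℘(z)` gives the Wronskians `φ' ψ - φ ψ'` as
residues. The two quadratic relations between `1, ℘, ℘', ℘''` give symmetric expressions that vanish
to second order, which are multiplied by `℘'(z)`. These residues span all functions with poles of
order at most `8` exactly because `g₂³ - 27 g₃² ≠ 0` (`discriminant_ne_zero`).

If `b = 0` or `c = 0`, residues for `k = 1` do not occur, since a function with at most a simple pole
along `{0} × E` and none along the diagonal is independent of `z`. The case `c = 0` is done
first; automorphisms of `E × E` which permute the three curves carry it to the cases `b = 0` and
`a = 0`, the latter being the start of the general induction.
-/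

noncomputable section

namespace EllipticSquare

/-! ### Elliptic functions with poles at the lattice points -/

theorem neg_natCast_le_order_iff {h : ℂ → ℂ} {x : ℂ} (hh : MeromorphicAt h x) (n : ℕ) :
    ((-(n : ℤ) : ℤ) : WithTop ℤ) ≤ meromorphicOrderAt h x ↔
      ∃ g : ℂ → ℂ, AnalyticAt ℂ g x ∧ ∀ᶠ z in 𝓝[≠] x, h z * (z - x) ^ n = g z := by
  have hm : MeromorphicAt (h * fun z => (z - x) ^ n) x := by fun_prop
  have ho : meromorphicOrderAt (h * fun z => (z - x) ^ n) x = meromorphicOrderAt h x + n := by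
    rw [meromorphicOrderAt_mul hh (by fun_prop)]
    exact congrArg _ meromorphicOrderAt_pow_id_sub_const
  have := hm.meromorphicOrderAt_nonneg_iff
  rw [ho] at this
  refine Iff.trans ?_ this
  cases meromorphicOrderAt h x with
  | top => simp
  | coe m => norm_cast; constructor <;> intro h <;> linarith

theorem meromorphicAt_of_mul_pow {h g : ℂ → ℂ} {x : ℂ} {n : ℕ} (hg : AnalyticAt ℂ g x)
    (hhg : ∀ᶠ z in 𝓝[≠] x, h z * (z - x) ^ n = g z) : MeromorphicAt h x := by
  have : MeromorphicAt (fun z => g z * ((z - x) ^ n)⁻¹) x := by fun_prop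
  refine this.congr ?_
  filter_upwards [hhg, self_mem_nhdsWithin] with z hz hzx
  have : (z - x) ^ n ≠ 0 := pow_ne_zero _ (sub_ne_zero.2 hzx)
  rw [← hz]
  field_simp

/-- `h` is an elliptic function for the lattice `Λ` whose only poles are the lattice points, each of
order at most `n`. Poles are measured by the meromorphic order, which ignores the values of `h` at
isolated points; periodicity is required everywhere. -/
structure PoleLE (P : PeriodPair) (n : ℕ) (h : ℂ → ℂ) : Prop where
  mero : Meromorphic h
  periodic : ∀ l ∈ P.lattice, ∀ z, h (z + l) = h z
  order_off : ∀ z ∉ P.lattice, 0 ≤ meromorphicOrderAt h z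
  order_zero : ((-(n : ℤ) : ℤ) : WithTop ℤ) ≤ meromorphicOrderAt h 0

theorem order_add_period {P : PeriodPair} {h : ℂ → ℂ}
    (hp : ∀ l ∈ P.lattice, ∀ z, h (z + l) = h z) {l : ℂ} (hl : l ∈ P.lattice) (z : ℂ) :
    meromorphicOrderAt h (z + l) = meromorphicOrderAt h z := by
  rw [← meromorphicOrderAt_comp_add_const_eq_meromorphicOrderAt]
  congr 1
  exact funext (hp l hl)

theorem PoleLE.order_on {P : PeriodPair} {n : ℕ} {h : ℂ → ℂ} (hh : PoleLE P n h) {l : ℂ}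
    (hl : l ∈ P.lattice) : ((-(n : ℤ) : ℤ) : WithTop ℤ) ≤ meromorphicOrderAt h l := by
  have := order_add_period hh.periodic hl 0
  rw [zero_add] at this
  rw [this]
  exact hh.order_zero

theorem PoleLE.mono {P : PeriodPair} {m n : ℕ} (hmn : m ≤ n) {h : ℂ → ℂ} (hh : PoleLE P m h) :
    PoleLE P n h := by
  refine ⟨hh.mero, hh.periodic, hh.order_off, le_trans ?_ hh.order_zero⟩
  norm_cast
  omega

theorem le_order_add {f g : ℂ → ℂ} {x : ℂ} {a : WithTop ℤ} (hf : MeromorphicAt f x)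
    (hg : MeromorphicAt g x) (h₁ : a ≤ meromorphicOrderAt f x) (h₂ : a ≤ meromorphicOrderAt g x) :
    a ≤ meromorphicOrderAt (f + g) x :=
  (le_min h₁ h₂).trans (meromorphicOrderAt_add hf hg)

theorem PoleLE.add {P : PeriodPair} {n : ℕ} {h k : ℂ → ℂ} (hh : PoleLE P n h)
    (hk : PoleLE P n k) : PoleLE P n (h + k) where
  mero := fun z => (hh.mero z).add (hk.mero z)
  periodic l hl z := by simp only [Pi.add_apply, hh.periodic l hl, hk.periodic l hl]
  order_off z hz := le_order_add (hh.mero z) (hk.mero z) (hh.order_off z hz) (hk.order_off z hz)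
  order_zero := le_order_add (hh.mero 0) (hk.mero 0) hh.order_zero hk.order_zero

theorem PoleLE.const (P : PeriodPair) (n : ℕ) (c : ℂ) : PoleLE P n fun _ => c where
  mero := fun z => analyticAt_const.meromorphicAt
  periodic _ _ _ := rfl
  order_off _ _ := analyticAt_const.meromorphicOrderAt_nonneg
  order_zero := le_trans (by norm_cast; simp) analyticAt_const.meromorphicOrderAt_nonneg

theorem PoleLE.mul {P : PeriodPair} {m n : ℕ} {h k : ℂ → ℂ} (hh : PoleLE P m h)
    (hk : PoleLE P n k) : PoleLE P (m + n) (h * k) where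
  mero := fun z => (hh.mero z).mul (hk.mero z)
  periodic l hl z := by simp only [Pi.mul_apply, hh.periodic l hl, hk.periodic l hl]
  order_off z hz := by
    rw [meromorphicOrderAt_mul (hh.mero z) (hk.mero z)]
    exact add_nonneg (hh.order_off z hz) (hk.order_off z hz)
  order_zero := by
    rw [meromorphicOrderAt_mul (hh.mero 0) (hk.mero 0)]
    refine le_trans (le_of_eq ?_) (add_le_add hh.order_zero hk.order_zero)
    norm_cast
    push_cast
    ring

theorem PoleLE.const_mul {P : PeriodPair} {n : ℕ} {h : ℂ → ℂ} (hh : PoleLE P n h) (c : ℂ) :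
    PoleLE P n fun z => c * h z := by
  have := (PoleLE.const P 0 c).mul hh
  rwa [zero_add] at this

/-- **Liouville's theorem** for elliptic functions. -/
theorem exists_eq_const_of_order_nonneg (P : PeriodPair) {h : ℂ → ℂ} (hm : Meromorphic h)
    (hp : ∀ l ∈ P.lattice, ∀ z, h (z + l) = h z) (ho : ∀ z, 0 ≤ meromorphicOrderAt h z) :
    ∃ c, ∀ z, h =ᶠ[𝓝[≠] z] fun _ => c := by
  have hm' : MeromorphicOn h Set.univ := fun z _ => hm z
  set H := toMeromorphicNFOn h Set.univ with hH
  have hHh : ∀ z, H =ᶠ[𝓝[≠] z] h := fun z =>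
    hm'.toMeromorphicNFOn_eq_self_on_nhdsNE (Set.mem_univ z)
  have hHa : ∀ z, AnalyticAt ℂ H z := fun z => by
    rw [← (meromorphicNFOn_toMeromorphicNFOn h Set.univ
      (Set.mem_univ z)).meromorphicOrderAt_nonneg_iff_analyticAt,
      meromorphicOrderAt_congr (hHh z)]
    exact ho z
  have hHd : Differentiable ℂ H := fun z => (hHa z).differentiableAt
  have hHp : ∀ z l, l ∈ P.lattice → H (z + l) = H z := by
    intro z l hl
    have h1 : Tendsto (fun w => H (w + l)) (𝓝[≠] z) (𝓝 (H (z + l))) :=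
      ((hHd.continuous.comp (continuous_add_const l)).tendsto z).mono_left nhdsWithin_le_nhds
    have h2 : Tendsto H (𝓝[≠] z) (𝓝 (H z)) :=
      (hHd.continuous.tendsto z).mono_left nhdsWithin_le_nhds
    have ht : Tendsto (· + l) (𝓝[≠] z) (𝓝[≠] (z + l)) :=
      (continuous_add_const l).continuousWithinAt.tendsto_nhdsWithin (by simp [Set.MapsTo])
    refine tendsto_nhds_unique (h1.congr' ?_) h2
    filter_upwards [hHh z, ht.eventually (hHh (z + l))] with w hw hw'
    rw [hw, hw', hp l hl]
  refine ⟨H 0, fun z => ?_⟩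
  have hb : Bornology.IsBounded (Set.range H) :=
    (IsZLattice.isCompact_range_of_periodic P.lattice H hHd.continuous hHp).isBounded
  filter_upwards [hHh z] with w hw
  rw [← hw]
  exact hHd.apply_eq_apply_of_bounded hb w 0

theorem tendsto_reflect (c : ℂ) : Tendsto (fun z => 2 * c - z) (𝓝[≠] c) (𝓝[≠] c) := by
  have : Tendsto (fun z => 2 * c - z) (𝓝[≠] c) (𝓝[≠] (2 * c - c)) := by
    refine (by fun_prop : Continuous fun z : ℂ => 2 * c - z).continuousWithinAt.tendsto_nhdsWithin ?_
    intro z hz h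
    apply hz
    have : 2 * c - z = 2 * c - c := h
    exact (sub_right_inj.1 this)
  rwa [show 2 * c - c = c by ring] at this

/-- An odd elliptic function without a pole at a half period vanishes there. -/
theorem order_pos_of_odd {P : PeriodPair} {k : ℂ → ℂ} (hm : Meromorphic k)
    (hp : ∀ l ∈ P.lattice, ∀ z, k (z + l) = k z)
    (hodd : ∀ z, ∀ᶠ w in 𝓝[≠] z, k (-w) = -k w) {c : ℂ} (hc : 2 * c ∈ P.lattice)
    (ho : 0 ≤ meromorphicOrderAt k c) : 0 < meromorphicOrderAt k c := by
  rw [← tendsto_zero_iff_meromorphicOrderAt_pos (hm c)]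
  obtain ⟨y, hy⟩ := (tendsto_nhds_iff_meromorphicOrderAt_nonneg (hm c)).2 ho
  have h1 := (hy.comp (tendsto_reflect c)).neg
  have h2 : Tendsto k (𝓝[≠] c) (𝓝 (-y)) := by
    refine h1.congr' ?_
    filter_upwards [hodd c] with w hw
    simp only [Function.comp]
    rw [sub_eq_neg_add, hp _ hc, hw, neg_neg]
  have : y = 0 := by
    have := tendsto_nhds_unique hy h2
    exact CharZero.eq_neg_self_iff.1 this
  rwa [this] at hy

theorem order_eq_top_of_point {k : ℂ → ℂ} (hm : Meromorphic k) {x : ℂ}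
    (hx : meromorphicOrderAt k x = ⊤) (z : ℂ) : meromorphicOrderAt k z = ⊤ := by
  by_contra hz
  exact MeromorphicOn.meromorphicOrderAt_ne_top_of_isPreconnected (U := Set.univ)
    (fun y _ => hm y) isPreconnected_univ (Set.mem_univ z) (Set.mem_univ x) hz hx

theorem half_periods_notMem (P : PeriodPair) : P.ω₁ / 2 ∉ P.lattice ∧ P.ω₂ / 2 ∉ P.lattice ∧
    P.ω₂ / 2 + P.ω₁ / 2 ∉ P.lattice := by
  refine ⟨P.ω₁_div_two_notMem_lattice, P.ω₂_div_two_notMem_lattice, ?_⟩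
  have := PeriodPair.mul_ω₁_add_mul_ω₂_mem_lattice (L := P) (α := 1 / 2) (β := 1 / 2)
  intro h
  have h' := this.1 (by convert h using 1; push_cast; ring)
  norm_num at h'

/-- There is no elliptic function with a single simple pole. After subtracting a constant such a
function `k` would be odd, hence vanish at the half periods. Then `k(z) k(z + ω₁/2)` has no poles,
so it is constant, and it vanishes at `ω₂/2`; therefore `k = 0`. -/
theorem PoleLE.exists_eq_const {P : PeriodPair} {h : ℂ → ℂ} (hh : PoleLE P 1 h) :
    ∃ c, ∀ z, h =ᶠ[𝓝[≠] z] fun _ => c := by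
  have hmn : Meromorphic fun z => h (-z) := fun z =>
    (hh.mero (-z)).comp_analyticAt (g := fun z => -z) (by fun_prop)
  have hpn : ∀ l ∈ P.lattice, ∀ z, h (-(z + l)) = h (-z) := fun l hl z => by
    rw [neg_add, hh.periodic _ (neg_mem hl)]
  have hon : ∀ z, meromorphicOrderAt (fun z => h (-z)) z = meromorphicOrderAt h (-z) := fun z =>
    meromorphicOrderAt_comp_of_deriv_ne_zero (f := h) (g := fun z => -z) (by fun_prop) (by simp)
  have hms : Meromorphic fun z => h z + h (-z) := fun z => (hh.mero z).add (hmn z)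
  have hps : ∀ l ∈ P.lattice, ∀ z, h (z + l) + h (-(z + l)) = h z + h (-z) := fun l hl z => by
    rw [hh.periodic l hl, hpn l hl]
  have hs0 : 0 ≤ meromorphicOrderAt (fun z => h z + h (-z)) 0 := by
    obtain ⟨g, hg, hgh⟩ := (neg_natCast_le_order_iff (hh.mero 0) 1).1 hh.order_zero
    have hmm : MeromorphicAt ((fun z => h z + h (-z)) * fun z : ℂ => (z - 0)) 0 := by
      have := hms 0
      fun_prop
    have hneg : Tendsto (fun z : ℂ => -z) (𝓝[≠] 0) (𝓝[≠] 0) := by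
      simpa using tendsto_reflect 0
    have ht : Tendsto ((fun z => h z + h (-z)) * fun z : ℂ => (z - 0)) (𝓝[≠] 0) (𝓝 0) := by
      have hc := hg.continuousAt.tendsto.mono_left (nhdsWithin_le_nhds (s := {0}ᶜ))
      have h1 := hc.sub (hc.comp hneg)
      rw [sub_self] at h1
      refine h1.congr' ?_
      filter_upwards [hgh, hneg.eventually hgh] with z hz hz'
      simp only [Function.comp, Pi.mul_apply, ← hz, ← hz']
      ring
    have := (tendsto_zero_iff_meromorphicOrderAt_pos hmm).1 ht
    rw [meromorphicOrderAt_mul (hms 0) (by fun_prop)] at this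
    have h1 : meromorphicOrderAt (fun z : ℂ => z - 0) 0 = 1 := 
      meromorphicOrderAt_id_sub_const
    rw [h1] at this
    revert this
    cases meromorphicOrderAt (fun z => h z + h (-z)) 0 with
    | top => simp
    | coe m => norm_cast; omega
  obtain ⟨c, hc⟩ := exists_eq_const_of_order_nonneg P hms hps fun z => by
    by_cases hz : z ∈ P.lattice
    · have := order_add_period (h := fun z => h z + h (-z)) hps hz 0
      rw [zero_add] at this
      rwa [this]
    · exact le_order_add (hh.mero z) (hmn z) (hh.order_off z hz)
        ((hon z).symm ▸ hh.order_off _ (by simpa using hz))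
  set k : ℂ → ℂ := fun z => h z + -(c / 2) with hk
  have hk1 : PoleLE P 1 k := hh.add (PoleLE.const P 1 (-(c / 2)))
  have hodd : ∀ z, ∀ᶠ w in 𝓝[≠] z, k (-w) = -k w := fun z => by
    filter_upwards [hc z] with w hw
    simp only [hk]
    linear_combination hw
  obtain ⟨n1, n2, n3⟩ := half_periods_notMem P
  have hpos : ∀ c ∉ P.lattice, 2 * c ∈ P.lattice → 0 < meromorphicOrderAt k c := fun c hc h2 =>
    order_pos_of_odd hk1.mero hk1.periodic hodd h2 (hk1.order_off c hc)
  have p1 := hpos _ n1 (by rw [mul_div_cancel₀ _ two_ne_zero]; exact P.ω₁_mem_lattice)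
  have p2 := hpos _ n2 (by rw [mul_div_cancel₀ _ two_ne_zero]; exact P.ω₂_mem_lattice)
  have hone : ∀ {a b : WithTop ℤ}, 0 < a → ((-((1 : ℕ) : ℤ) : ℤ) : WithTop ℤ) ≤ b →
      0 ≤ a + b := by
    intro a b
    cases a with
    | top => simp
    | coe a => cases b with
      | top => simp
      | coe b => norm_cast; omega
  have hsh : Meromorphic fun z => k (z + P.ω₁ / 2) := fun z =>
    (hk1.mero _).comp_analyticAt (g := fun z => z + P.ω₁ / 2) (by fun_prop)
  have hosh : ∀ z, meromorphicOrderAt (fun z => k (z + P.ω₁ / 2)) z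
      = meromorphicOrderAt k (z + P.ω₁ / 2) := fun z =>
    meromorphicOrderAt_fun_comp_add_const_eq_meromorphicOrderAt
  have hmul : ∀ z, meromorphicOrderAt (k * fun z => k (z + P.ω₁ / 2)) z
      = meromorphicOrderAt k z + meromorphicOrderAt k (z + P.ω₁ / 2) := fun z => by
    rw [meromorphicOrderAt_mul (hk1.mero z) (hsh z), hosh]
  obtain ⟨d, hd⟩ := exists_eq_const_of_order_nonneg P
    (h := k * fun z => k (z + P.ω₁ / 2)) (fun z => (hk1.mero z).mul (hsh z))
    (fun l hl z => by
      simp only [Pi.mul_apply]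
      rw [hk1.periodic l hl, add_right_comm, hk1.periodic l hl])
    (fun z => by
      rw [hmul]
      by_cases hz : z ∈ P.lattice
      · have := order_add_period hk1.periodic hz (P.ω₁ / 2)
        rw [add_comm z, this, add_comm]
        exact hone p1 (hk1.order_on hz)
      · by_cases hz' : z + P.ω₁ / 2 ∈ P.lattice
        · refine hone ?_ (hk1.order_on hz')
          have := order_add_period hk1.periodic (sub_mem hz' P.ω₁_mem_lattice) (P.ω₁ / 2)
          rw [show P.ω₁ / 2 + (z + P.ω₁ / 2 - P.ω₁) = z by ring] at this
          rwa [this]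
        · exact add_nonneg (hk1.order_off _ hz) (hk1.order_off _ hz'))
  have hd0 : d = 0 := by
    have hpos2 : 0 < meromorphicOrderAt (k * fun z => k (z + P.ω₁ / 2)) (P.ω₂ / 2) := by
      rw [hmul]
      exact add_pos_of_pos_of_nonneg p2 (hk1.order_off _ n3)
    have := tendsto_zero_of_meromorphicOrderAt_pos hpos2
    exact tendsto_nhds_unique (tendsto_const_nhds.congr' (hd (P.ω₂ / 2)).symm) this
  have htop : meromorphicOrderAt k 0 + meromorphicOrderAt k (0 + P.ω₁ / 2) = ⊤ := by
    rw [← hmul, meromorphicOrderAt_eq_top_iff]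
    filter_upwards [hd 0] with z hz
    rw [hz, hd0]
  have hktop : ∀ z, meromorphicOrderAt k z = ⊤ := by
    rcases WithTop.add_eq_top.1 htop with h | h
    · exact order_eq_top_of_point hk1.mero h
    · exact order_eq_top_of_point hk1.mero h
  refine ⟨c / 2, fun z => ?_⟩
  filter_upwards [meromorphicOrderAt_eq_top_iff.1 (hktop z)] with w hw
  simp only [hk] at hw
  linear_combination hw

/-! ### The functions `1, ℘, ℘', ℘''` and their products -/

/-- The functions `1, ℘, ℘', ℘''` as functions on `ℂ`. -/
def rowFun (P : PeriodPair) (j : Fin 4) (z : ℂ) : ℂ := row P j (proj P z)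

@[simp] theorem rowFun_zero (P : PeriodPair) (z : ℂ) : rowFun P 0 z = 1 := rfl

@[simp] theorem rowFun_one (P : PeriodPair) (z : ℂ) : rowFun P 1 z = P.weierstrassP z := rfl

@[simp] theorem rowFun_two (P : PeriodPair) (z : ℂ) : rowFun P 2 z = P.derivWeierstrassP z := rfl

@[simp] theorem rowFun_three (P : PeriodPair) (z : ℂ) :
    rowFun P 3 z = deriv P.derivWeierstrassP z := rfl

theorem proj_add_period {P : PeriodPair} {l : ℂ} (hl : l ∈ P.lattice) (z : ℂ) :
    proj P (z + l) = proj P z := by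
  rw [proj, proj, Submodule.Quotient.eq]
  simpa using hl

theorem proj_eq_zero {P : PeriodPair} {z : ℂ} : proj P z = 0 ↔ z ∈ P.lattice :=
  Submodule.Quotient.mk_eq_zero _

theorem rowFun_add_period {P : PeriodPair} (j : Fin 4) {l : ℂ} (hl : l ∈ P.lattice) (z : ℂ) :
    rowFun P j (z + l) = rowFun P j z := by
  rw [rowFun, rowFun, proj_add_period hl]

theorem lattice_compl_mem_nhds {P : PeriodPair} {z : ℂ} (hz : z ∉ P.lattice) :
    ∀ᶠ w in 𝓝 z, w ∉ P.lattice :=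
  P.isClosed_lattice.isOpen_compl.mem_nhds hz

theorem eventually_notMem_lattice (P : PeriodPair) (z : ℂ) : ∀ᶠ w in 𝓝[≠] z, w ∉ P.lattice := by
  filter_upwards [self_mem_nhdsWithin,
    mem_nhdsWithin_of_mem_nhds (P.compl_lattice_sdiff_singleton_mem_nhds z)] with w hw hw' h
  exact hw' ⟨h, hw⟩

theorem analyticAt_rowFun {P : PeriodPair} (j : Fin 4) {z : ℂ} (hz : z ∉ P.lattice) :
    AnalyticAt ℂ (rowFun P j) z := by
  fin_cases j
  · exact analyticAt_const
  · exact P.analyticOnNhd_weierstrassP z hz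
  · exact P.analyticOnNhd_derivWeierstrassP z hz
  · exact (P.analyticOnNhd_derivWeierstrassP z hz).deriv

theorem meromorphic_rowFun (P : PeriodPair) (j : Fin 4) : Meromorphic (rowFun P j) := by
  fin_cases j
  · exact fun z => analyticAt_const.meromorphicAt
  · exact P.meromorphic_weierstrassP
  · exact P.meromorphic_derivWeierstrassP
  · exact fun z => (P.meromorphic_derivWeierstrassP z).deriv

/-- The pole orders of `1, ℘, ℘', ℘''`. -/
def rowOrder : Fin 4 → ℕ := ![0, 2, 3, 4]

theorem order_rowFun (P : PeriodPair) (j : Fin 4) :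
    meromorphicOrderAt (rowFun P j) 0 = ((-(rowOrder j : ℤ) : ℤ) : WithTop ℤ) := by
  have h1 : meromorphicOrderAt P.weierstrassP 0 = ((-2 : ℤ) : WithTop ℤ) :=
    P.order_weierstrassP 0 (zero_mem _)
  have h2 : meromorphicOrderAt P.derivWeierstrassP 0 = ((-3 : ℤ) : WithTop ℤ) := by
    have := meromorphicOrderAt_deriv_eq_sub_one (n := -2) (by norm_num) h1
    rwa [P.deriv_weierstrassP] at this
  have h3 : meromorphicOrderAt (deriv P.derivWeierstrassP) 0 = ((-4 : ℤ) : WithTop ℤ) :=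
    meromorphicOrderAt_deriv_eq_sub_one (n := -3) (by norm_num) h2
  fin_cases j
  · change meromorphicOrderAt (fun _ => (1 : ℂ)) 0 = _
    rw [meromorphicOrderAt_const]
    simp [rowOrder]
  · exact h1
  · exact h2
  · exact h3

/-- The signs by which `1, ℘, ℘', ℘''` change under `z ↦ -z`. -/
def rowSign : Fin 4 → ℂ := ![1, 1, -1, 1]

theorem rowSign_mul_self (j : Fin 4) : rowSign j * rowSign j = 1 := by
  fin_cases j <;> simp [rowSign]

theorem rowFun_neg (P : PeriodPair) (j : Fin 4) (z : ℂ) :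
    rowFun P j (-z) = rowSign j * rowFun P j z := by
  fin_cases j
  · simp [rowSign]
  · simp [rowSign]
  · simp [rowSign]
  · have h : (fun z => P.derivWeierstrassP (-z)) = fun z => -P.derivWeierstrassP z :=
      funext P.derivWeierstrassP_neg
    have := deriv_comp_neg P.derivWeierstrassP z
    rw [h, deriv.fun_neg] at this
    simpa [rowSign] using (neg_injective this).symm

theorem row_neg (P : PeriodPair) (j : Fin 4) (x : Curve P) :
    row P j (-x) = rowSign j * row P j x := by
  obtain ⟨z, rfl⟩ := Submodule.Quotient.mk_surjective _ x
  exact rowFun_neg P j z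

theorem eventually_ne_of_order_neg {h : ℂ → ℂ} (hm : Meromorphic h)
    (h0 : meromorphicOrderAt h 0 < 0) (c z : ℂ) : ∀ᶠ w in 𝓝[≠] z, h w ≠ c := by
  have hmc : Meromorphic fun w => h w - c := fun z => (hm z).sub analyticAt_const.meromorphicAt
  have hne : meromorphicOrderAt (fun w => h w - c) z ≠ ⊤ := fun htop => by
    have h1 := meromorphicOrderAt_eq_top_iff.1 (order_eq_top_of_point hmc htop 0)
    have h2 : h =ᶠ[𝓝[≠] 0] fun _ => c := by
      filter_upwards [h1] with w hw using sub_eq_zero.1 hw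
    rw [meromorphicOrderAt_congr h2] at h0
    exact absurd analyticAt_const.meromorphicOrderAt_nonneg (not_le.2 h0)
  filter_upwards [(meromorphicOrderAt_ne_top_iff_eventually_ne_zero (hmc z)).1 hne] with w hw h
  exact hw (sub_eq_zero.2 h)

theorem order_weierstrassP_neg (P : PeriodPair) : meromorphicOrderAt P.weierstrassP 0 < 0 := by
  rw [P.order_weierstrassP 0 (zero_mem _)]
  decide

theorem order_derivWeierstrassP_neg (P : PeriodPair) :
    meromorphicOrderAt P.derivWeierstrassP 0 < 0 := by
  have := order_rowFun P 2
  change meromorphicOrderAt P.derivWeierstrassP 0 = _ at this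
  rw [this]
  decide

theorem hasDerivAt_weierstrassP {P : PeriodPair} {z : ℂ} (hz : z ∉ P.lattice) :
    HasDerivAt P.weierstrassP (P.derivWeierstrassP z) z := by
  rw [← P.deriv_weierstrassP]
  exact (P.analyticOnNhd_weierstrassP z hz).differentiableAt.hasDerivAt

theorem hasDerivAt_derivWeierstrassP {P : PeriodPair} {z : ℂ} (hz : z ∉ P.lattice) :
    HasDerivAt P.derivWeierstrassP (deriv P.derivWeierstrassP z) z :=
  (P.analyticOnNhd_derivWeierstrassP z hz).differentiableAt.hasDerivAt

/-- `℘'' = 6 ℘² - g₂ / 2`, by differentiating the Weierstrass equation. -/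
theorem deriv_derivWeierstrassP {P : PeriodPair} {z : ℂ} (hz : z ∉ P.lattice) :
    deriv P.derivWeierstrassP z = 6 * P.weierstrassP z ^ 2 - P.g₂ / 2 := by
  have hu := (P.analyticOnNhd_weierstrassP z hz).continuousAt
  have hq := (P.analyticOnNhd_derivWeierstrassP z hz).deriv.continuousAt
  have key : deriv P.derivWeierstrassP =ᶠ[𝓝[≠] z]
      fun w => 6 * P.weierstrassP w ^ 2 - P.g₂ / 2 := by
    filter_upwards [(eventually_ne_of_order_neg P.meromorphic_derivWeierstrassP
      (order_derivWeierstrassP_neg P) 0 z), eventually_notMem_lattice P z] with w hw hwl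
    have h1 := (hasDerivAt_derivWeierstrassP hwl).pow 2
    have hd := hasDerivAt_weierstrassP hwl
    have h2 := (((hd.pow 3).const_mul 4).sub (hd.const_mul P.g₂)).sub_const P.g₃
    have h3 := h1.unique (h2.congr_of_eventuallyEq (by
      filter_upwards [lattice_compl_mem_nhds hwl] with y hy
      simpa using P.derivWeierstrassP_sq y hy))
    have : 2 * P.derivWeierstrassP w * (deriv P.derivWeierstrassP w -
        (6 * P.weierstrassP w ^ 2 - P.g₂ / 2)) = 0 := by
      norm_num at h3
      linear_combination h3
    have h4 := (mul_eq_zero.1 this).resolve_left (mul_ne_zero two_ne_zero hw)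
    exact sub_eq_zero.1 h4
  exact tendsto_nhds_unique (hq.tendsto.mono_left nhdsWithin_le_nhds)
    ((((hu.pow 2).const_mul 6).sub continuousAt_const).tendsto.mono_left nhdsWithin_le_nhds
      |>.congr' key.symm)

theorem hasDerivAt_deriv_derivWeierstrassP {P : PeriodPair} {z : ℂ} (hz : z ∉ P.lattice) :
    HasDerivAt (deriv P.derivWeierstrassP) (12 * P.weierstrassP z * P.derivWeierstrassP z) z := by
  have h := ((hasDerivAt_weierstrassP hz).pow 2).const_mul 6 |>.sub_const (P.g₂ / 2)
  refine (h.congr_of_eventuallyEq ?_).congr_deriv ?_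
  · filter_upwards [lattice_compl_mem_nhds hz] with w hw
    exact deriv_derivWeierstrassP hw
  · norm_num
    ring

/-- The discriminant of the Weierstrass cubic does not vanish: if the cubic were
`4 (x - e)² (x + 2e)`, then `℘' / (℘ - e)` would have simple poles at the lattice points
and no other poles. -/
theorem discriminant_ne_zero (P : PeriodPair) : P.g₂ ^ 3 - 27 * P.g₃ ^ 2 ≠ 0 := by
  intro hD
  obtain ⟨e, he2, he3⟩ : ∃ e, P.g₂ = 12 * e ^ 2 ∧ P.g₃ = -8 * e ^ 3 := by
    by_cases h : P.g₂ = 0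
    · refine ⟨0, by simp [h], ?_⟩
      simpa [h] using hD
    · refine ⟨-3 * P.g₃ / (2 * P.g₂), ?_, ?_⟩
      · field_simp
        linear_combination 4 * hD
      · field_simp
        linear_combination 8 * P.g₃ * hD
  set u := P.weierstrassP with hu
  set v := P.derivWeierstrassP with hv
  set f : ℂ → ℂ := fun z => v z / (u z - e) with hf
  have hum : Meromorphic u := P.meromorphic_weierstrassP
  have hvm : Meromorphic v := P.meromorphic_derivWeierstrassP
  have hfm : Meromorphic f := fun z => by
    have := hum z
    have := hvm z
    fun_prop
  have hsq : ∀ z, (f ^ 2) =ᶠ[𝓝[≠] z] fun w => 4 * (u w + 2 * e) := fun z => by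
    filter_upwards [eventually_notMem_lattice P z,
      eventually_ne_of_order_neg hum (order_weierstrassP_neg P) e z] with w hw hne
    have h0 : u w - e ≠ 0 := sub_ne_zero.2 hne
    have h1 := P.derivWeierstrassP_sq w hw
    simp only [hf, Pi.pow_apply]
    rw [div_pow, div_eq_iff (pow_ne_zero 2 h0)]
    rw [he2, he3] at h1
    linear_combination h1
  have hord : ∀ z, meromorphicOrderAt f z + meromorphicOrderAt f z
      = meromorphicOrderAt (fun w => 4 * (u w + 2 * e)) z := fun z => by
    rw [← meromorphicOrderAt_congr (hsq z), pow_two, meromorphicOrderAt_mul (hfm z) (hfm z)]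
  have hup : PoleLE P 2 u := ⟨hum, fun l hl z => P.weierstrassP_add_coe z ⟨l, hl⟩,
    fun z hz => (P.analyticOnNhd_weierstrassP z hz).meromorphicOrderAt_nonneg, by
      rw [hu, P.order_weierstrassP 0 (zero_mem _)]; exact le_refl _⟩
  have hup' : PoleLE P 2 fun w => 4 * (u w + 2 * e) :=
    PoleLE.const_mul (hup.add (PoleLE.const P 2 (2 * e))) 4
  have hf1 : PoleLE P 1 f := by
    refine ⟨hfm, fun l hl z => ?_, fun z hz => ?_, ?_⟩
    · simp only [hf]
      rw [hup.periodic l hl]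
      congr 1
      exact P.derivWeierstrassP_add_coe z ⟨l, hl⟩
    · have h1 := hup'.order_off z hz
      rw [← hord] at h1
      revert h1
      cases meromorphicOrderAt f z with
      | top => simp
      | coe m => norm_cast; omega
    · have h1 := hup'.order_zero
      rw [← hord] at h1
      revert h1
      cases meromorphicOrderAt f 0 with
      | top => simp
      | coe m => norm_cast; omega
  obtain ⟨c, hc⟩ := hf1.exists_eq_const
  have hconst : u =ᶠ[𝓝[≠] 0] fun _ => c ^ 2 / 4 - 2 * e := by
    filter_upwards [hc 0, hsq 0] with w hw hw'
    rw [Pi.pow_apply, hw] at hw'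
    linear_combination -hw' / 4
  have := order_weierstrassP_neg P
  rw [meromorphicOrderAt_congr hconst] at this
  exact absurd analyticAt_const.meromorphicOrderAt_nonneg (not_le.2 this)

/-- The span of the products of `n` of the functions `1, ℘, ℘', ℘''`. -/
def productSpan (P : PeriodPair) (n : ℕ) : Submodule ℂ (ℂ → ℂ) :=
  Submodule.span ℂ {φ | ∃ i : Fin n → Fin 4, φ = fun z => ∏ r, rowFun P (i r) z}

theorem prod_mem_productSpan (P : PeriodPair) {n : ℕ} (i : Fin n → Fin 4) :
    (fun z => ∏ r, rowFun P (i r) z) ∈ productSpan P n :=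
  Submodule.subset_span ⟨i, rfl⟩

theorem analyticAt_of_mem_productSpan {P : PeriodPair} {n : ℕ} {t : ℂ → ℂ}
    (ht : t ∈ productSpan P n) {z : ℂ} (hz : z ∉ P.lattice) : AnalyticAt ℂ t z := by
  induction ht using Submodule.span_induction with
  | mem x hx =>
    obtain ⟨i, rfl⟩ := hx
    exact Finset.analyticAt_fun_prod _ fun r _ => analyticAt_rowFun (i r) hz
  | zero => exact analyticAt_const
  | add x y _ _ hx hy => exact hx.add hy
  | smul a x _ hx => exact analyticAt_const.mul hx

/-- Sums of `n` of the numbers `0, 2, 3, 4` are all the numbers up to `4n` except `1`. -/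
theorem exists_sum_rowOrder (n k : ℕ) (hk : k ≤ 4 * n) (h1 : k ≠ 1) :
    ∃ i : Fin n → Fin 4, ∑ r, rowOrder (i r) = k := by
  induction n generalizing k with
  | zero => exact ⟨Fin.elim0, by simp; omega⟩
  | succ n ih =>
    suffices ∃ j : Fin 4, rowOrder j ≤ k ∧ k - rowOrder j ≤ 4 * n ∧ k - rowOrder j ≠ 1 by
      obtain ⟨j, hj, hj1, hj2⟩ := this
      obtain ⟨i, hi⟩ := ih _ hj1 hj2
      refine ⟨Fin.cons j i, ?_⟩
      rw [Fin.sum_univ_succ]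
      simp only [Fin.cons_zero, Fin.cons_succ]
      omega
    by_cases h0 : k ≤ 4 * n
    · exact ⟨0, by simp [rowOrder], by simpa [rowOrder] using h0, by simpa [rowOrder] using h1⟩
    · by_cases h4 : 4 ≤ k ∧ k ≠ 5
      · exact ⟨3, by simp [rowOrder]; omega, by simp [rowOrder]; omega, by simp [rowOrder]; omega⟩
      · by_cases h5 : k = 2
        · exact ⟨1, by simp [rowOrder]; omega, by simp [rowOrder]; omega,
            by simp [rowOrder]; omega⟩
        · exact ⟨2, by simp [rowOrder]; omega, by simp [rowOrder]; omega,
            by simp [rowOrder]; omega⟩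

theorem order_prod_rowFun (P : PeriodPair) {n : ℕ} (i : Fin n → Fin 4) :
    meromorphicOrderAt (fun z => ∏ r, rowFun P (i r) z) 0
      = ((-((∑ r, rowOrder (i r) : ℕ) : ℤ) : ℤ) : WithTop ℤ) := by
  rw [meromorphicOrderAt_fun_prod fun r _ => meromorphic_rowFun P (i r) 0]
  simp_rw [order_rowFun]
  rw [← WithTop.coe_sum, Finset.sum_neg_distrib, Nat.cast_sum]

/-- For `k ≠ 1`, `k ≤ 4n` there is a product of `n` of the functions `1, ℘, ℘', ℘''` with a pole of
order exactly `k` at the origin. -/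
theorem exists_prod_tendsto (P : PeriodPair) (n k : ℕ) (hk : k ≤ 4 * n) (h1 : k ≠ 1) :
    ∃ i : Fin n → Fin 4,
      meromorphicOrderAt (fun z => ∏ r, rowFun P (i r) z) 0 = ((-(k : ℤ) : ℤ) : WithTop ℤ) ∧
      ∃ c ≠ 0, Tendsto (fun z => z ^ k * ∏ r, rowFun P (i r) z) (𝓝[≠] 0) (𝓝 c) := by
  obtain ⟨i, hi⟩ := exists_sum_rowOrder n k hk h1
  have ho := order_prod_rowFun P i
  rw [hi] at ho
  refine ⟨i, ho, ?_⟩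
  have hm : MeromorphicAt (fun z => ∏ r, rowFun P (i r) z) 0 :=
    MeromorphicAt.fun_prod fun r _ => meromorphic_rowFun P (i r) 0
  obtain ⟨g, hg, hg0, h⟩ := (meromorphicOrderAt_eq_int_iff hm).1 ho
  refine ⟨g 0, hg0, (hg.continuousAt.tendsto.mono_left nhdsWithin_le_nhds).congr' ?_⟩
  filter_upwards [h, self_mem_nhdsWithin] with z hz hz0
  have : z ^ k ≠ 0 := pow_ne_zero _ hz0
  rw [hz, sub_zero, zpow_neg, zpow_natCast, smul_eq_mul]
  field_simp

theorem PoleLE.exists_tendsto {P : PeriodPair} {n : ℕ} {h : ℂ → ℂ} (hh : PoleLE P n h) :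
    ∃ c, Tendsto (fun z => z ^ n * h z) (𝓝[≠] 0) (𝓝 c) := by
  obtain ⟨g, hg, h⟩ := (neg_natCast_le_order_iff (hh.mero 0) n).1 hh.order_zero
  refine ⟨g 0, (hg.continuousAt.tendsto.mono_left nhdsWithin_le_nhds).congr' ?_⟩
  filter_upwards [h] with z hz
  rw [← hz, sub_zero, mul_comm]

theorem PoleLE.of_tendsto_zero {P : PeriodPair} {n : ℕ} {h : ℂ → ℂ} (hh : PoleLE P (n + 1) h)
    (ht : Tendsto (fun z => z ^ (n + 1) * h z) (𝓝[≠] 0) (𝓝 0)) : PoleLE P n h := by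
  refine ⟨hh.mero, hh.periodic, hh.order_off, ?_⟩
  have hpm : MeromorphicAt (fun z : ℂ => z ^ (n + 1)) 0 := by fun_prop
  have h1 := (tendsto_zero_iff_meromorphicOrderAt_pos (hpm.mul (hh.mero 0))).1 ht
  rw [meromorphicOrderAt_mul hpm (hh.mero 0)] at h1
  have h2 : meromorphicOrderAt (fun z : ℂ => z ^ (n + 1)) 0 = ((n + 1 : ℕ) : WithTop ℤ) := by
    have := meromorphicOrderAt_pow_id_sub_const (𝕜 := ℂ) (x := 0) (n := n + 1)
    simp only [sub_zero] at this
    exact this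
  rw [h2] at h1
  revert h1
  cases meromorphicOrderAt h 0 with
  | top => simp
  | coe m => norm_cast; push_cast; omega

theorem const_mem_productSpan (P : PeriodPair) (n : ℕ) (c : ℂ) :
    (fun _ => c) ∈ productSpan P n := by
  have := Submodule.smul_mem _ c (prod_mem_productSpan P (n := n) fun _ => 0)
  convert this using 1
  ext z
  simp

/-- An elliptic function whose poles are at the lattice points and of order at most `4n` is a linear
combination of products of `n` of the functions `1, ℘, ℘', ℘''`. -/
theorem PoleLE.exists_mem_productSpan {P : PeriodPair} {n m : ℕ} (hmn : m ≤ 4 * n) {h : ℂ → ℂ}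
    (hh : PoleLE P m h) : ∃ t ∈ productSpan P n, ∀ z, h =ᶠ[𝓝[≠] z] t := by
  induction m generalizing h with
  | zero =>
    obtain ⟨c, hc⟩ := (hh.mono zero_le_one).exists_eq_const
    exact ⟨_, const_mem_productSpan P n c, hc⟩
  | succ m ih =>
    by_cases hm : m = 0
    · subst hm
      obtain ⟨c, hc⟩ := hh.exists_eq_const
      exact ⟨_, const_mem_productSpan P n c, hc⟩
    obtain ⟨i, ho, c, hc0, hc⟩ := exists_prod_tendsto P n (m + 1) hmn (by omega)
    obtain ⟨d, hd⟩ := hh.exists_tendsto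
    set φ : ℂ → ℂ := fun z => ∏ r, rowFun P (i r) z with hφ
    have hφp : PoleLE P (m + 1) φ :=
      ⟨fun z => MeromorphicAt.fun_prod fun r _ => meromorphic_rowFun P (i r) z,
        fun l hl z => by simp only [hφ, rowFun_add_period _ hl],
        fun z hz => (analyticAt_of_mem_productSpan (prod_mem_productSpan P i)
          hz).meromorphicOrderAt_nonneg,
        ho.ge⟩
    have hsub := hh.add (hφp.const_mul (-(d / c)))
    obtain ⟨t, ht, hte⟩ := ih (by omega) (hsub.of_tendsto_zero (by
      have := hd.add (hc.const_mul (-(d / c)))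
      rw [neg_mul, div_mul_cancel₀ _ hc0, add_neg_cancel] at this
      refine this.congr fun z => ?_
      simp only [Pi.add_apply]
      ring))
    refine ⟨t + (d / c) • φ, add_mem ht (Submodule.smul_mem _ _ (prod_mem_productSpan P i)),
      fun z => ?_⟩
    filter_upwards [hte z] with w hw
    rw [Pi.add_apply, ← hw]
    simp

/-! ### Division of analytic functions of two variables by a coordinate -/

/-- The monomial `(z, w) ↦ z ^ k * w ^ (n - k)`, for `k ≤ n`, as a multilinear map. -/
def monomialMap (k n : ℕ) : ContinuousMultilinearMap ℂ (fun _ : Fin n => ℂ × ℂ) ℂ :=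
  (ContinuousMultilinearMap.mkPiAlgebraFin ℂ n ℂ).compContinuousLinearMap fun i =>
    if (i : ℕ) < k then ContinuousLinearMap.fst ℂ ℂ ℂ else ContinuousLinearMap.snd ℂ ℂ ℂ

theorem monomialMap_apply {k n : ℕ} (hk : k ≤ n) (x : ℂ × ℂ) :
    monomialMap k n (fun _ => x) = x.1 ^ k * x.2 ^ (n - k) := by
  have h : monomialMap k n (fun _ => x) = ∏ i : Fin n, if (i : ℕ) < k then x.1 else x.2 := by
    simp only [monomialMap, ContinuousMultilinearMap.compContinuousLinearMap_apply,
      ContinuousMultilinearMap.mkPiAlgebraFin_apply, List.prod_ofFn]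
    refine Finset.prod_congr rfl fun i _ => ?_
    split_ifs <;> rfl
  rw [h, Fin.prod_univ_eq_prod_range (fun i => if i < k then x.1 else x.2) n]
  obtain ⟨m, rfl⟩ := Nat.exists_eq_add_of_le hk
  rw [Finset.prod_range_add]
  rw [Finset.prod_congr rfl (g := fun _ => x.1) fun i hi => if_pos (Finset.mem_range.1 hi)]
  simp

theorem norm_monomialMap_le (k n : ℕ) : ‖monomialMap k n‖ ≤ 1 := by
  refine (ContinuousMultilinearMap.norm_compContinuousLinearMap_le _ _).trans ?_
  rw [ContinuousMultilinearMap.norm_mkPiAlgebraFin, one_mul]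
  refine Finset.prod_le_one (fun _ _ => norm_nonneg _) fun i _ => ?_
  split_ifs
  · exact ContinuousLinearMap.norm_fst_le _ _ _
  · exact ContinuousLinearMap.norm_snd_le _ _ _

/-- The coefficients of the expansion of a multilinear map on `ℂ × ℂ` into monomials. -/
def monomialCoeff {n : ℕ} (p : ContinuousMultilinearMap ℂ (fun _ : Fin n => ℂ × ℂ) ℂ)
    (s : Finset (Fin n)) : ℂ :=
  p (s.piecewise (fun _ => (1, 0)) fun _ => (0, 1))

theorem norm_monomialCoeff_le {n : ℕ} (p : ContinuousMultilinearMap ℂ (fun _ : Fin n => ℂ × ℂ) ℂ)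
    (s : Finset (Fin n)) : ‖monomialCoeff p s‖ ≤ ‖p‖ := by
  refine (p.le_opNorm _).trans (mul_le_of_le_one_right (norm_nonneg _) ?_)
  refine Finset.prod_le_one (fun _ _ => norm_nonneg _) fun i _ => ?_
  by_cases h : i ∈ s <;> simp [h]

theorem apply_eq_sum_monomialCoeff {n : ℕ}
    (p : ContinuousMultilinearMap ℂ (fun _ : Fin n => ℂ × ℂ) ℂ) (x : ℂ × ℂ) :
    p (fun _ => x) = ∑ s : Finset (Fin n), x.1 ^ s.card * x.2 ^ (n - s.card) *
      monomialCoeff p s := by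
  have hx : (fun _ : Fin n => x) = (fun _ => x.1 • ((1, 0) : ℂ × ℂ)) +
      fun _ => x.2 • ((0, 1) : ℂ × ℂ) := by
    ext i <;> simp
  rw [hx, p.map_add_univ]
  refine Finset.sum_congr rfl fun s _ => ?_
  have : s.piecewise (fun _ => x.1 • ((1, 0) : ℂ × ℂ)) (fun _ => x.2 • ((0, 1) : ℂ × ℂ)) =
      fun i => (s.piecewise (fun _ => x.1) (fun _ => x.2) i : ℂ) •
        (s.piecewise (fun _ => ((1, 0) : ℂ × ℂ)) (fun _ => (0, 1)) i) := by
    funext i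
    by_cases h : i ∈ s <;> simp [h]
  rw [this, p.map_smul_univ, Finset.prod_piecewise, smul_eq_mul, monomialCoeff]
  simp [Finset.card_sdiff]

/-- The power series of the quotient by the first coordinate. -/
def divFstSeries (p : FormalMultilinearSeries ℂ (ℂ × ℂ) ℂ) :
    FormalMultilinearSeries ℂ (ℂ × ℂ) ℂ := fun n =>
  ∑ s : Finset (Fin (n + 1)) with s.Nonempty,
    monomialCoeff (p (n + 1)) s • monomialMap (s.card - 1) n

/-- The hypothesis says that the homogeneous part of degree `n + 1` has no term in `w ^ (n + 1)`. -/
theorem fst_mul_divFstSeries (p : FormalMultilinearSeries ℂ (ℂ × ℂ) ℂ) (n : ℕ) (x : ℂ × ℂ)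
    (h : monomialCoeff (p (n + 1)) ∅ = 0) :
    x.1 * divFstSeries p n (fun _ => x) = p (n + 1) fun _ => x := by
  rw [apply_eq_sum_monomialCoeff (p (n + 1)), divFstSeries, sum_apply, Finset.mul_sum,
    Finset.sum_filter]
  refine Finset.sum_congr rfl fun s _ => ?_
  split_ifs with hs
  · have h1 := hs.card_pos
    have h2 : s.card ≤ n + 1 := by simpa using s.card_le_univ
    rw [smul_apply, monomialMap_apply (by omega), smul_eq_mul]
    obtain ⟨m, hm⟩ : ∃ m, s.card = m + 1 := ⟨s.card - 1, by omega⟩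
    rw [hm, Nat.add_sub_cancel, Nat.add_sub_add_right]
    ring
  · rw [Finset.not_nonempty_iff_eq_empty.1 hs, h, mul_zero]

theorem norm_divFstSeries_le (p : FormalMultilinearSeries ℂ (ℂ × ℂ) ℂ) (n : ℕ) :
    ‖divFstSeries p n‖ ≤ 2 ^ (n + 1) * ‖p (n + 1)‖ := by
  calc ‖divFstSeries p n‖
      ≤ ∑ s : Finset (Fin (n + 1)) with s.Nonempty, ‖p (n + 1)‖ := by
        refine norm_sum_le_of_le _ fun s _ => ?_
        rw [norm_smul]
        exact (mul_le_mul (norm_monomialCoeff_le _ _) (norm_monomialMap_le _ _) (norm_nonneg _)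
          (norm_nonneg _)).trans_eq (mul_one _)
    _ ≤ ∑ s : Finset (Fin (n + 1)), ‖p (n + 1)‖ :=
        Finset.sum_le_sum_of_subset_of_nonneg (Finset.filter_subset _ _)
          fun _ _ _ => norm_nonneg _
    _ = 2 ^ (n + 1) * ‖p (n + 1)‖ := by simp

theorem divFstSeries_radius_pos (p : FormalMultilinearSeries ℂ (ℂ × ℂ) ℂ) (hp : 0 < p.radius) :
    0 < (divFstSeries p).radius := by
  obtain ⟨C, r, hC, hr, hb⟩ := p.le_mul_pow_of_radius_pos hp
  have hr' : (0 : ℝ) < (2 * r)⁻¹ := by positivity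
  set ρ : NNReal := ⟨(2 * r)⁻¹, hr'.le⟩ with hρ
  have : (ρ : ENNReal) ≤ (divFstSeries p).radius := by
    refine FormalMultilinearSeries.le_radius_of_bound _ (2 * C * r) fun n => ?_
    have h1 : ‖divFstSeries p n‖ ≤ 2 ^ (n + 1) * (C * r ^ (n + 1)) :=
      (norm_divFstSeries_le p n).trans (by gcongr; exact hb _)
    change ‖divFstSeries p n‖ * ((2 * r)⁻¹) ^ n ≤ 2 * C * r
    calc ‖divFstSeries p n‖ * ((2 * r)⁻¹) ^ n
        ≤ 2 ^ (n + 1) * (C * r ^ (n + 1)) * ((2 * r)⁻¹) ^ n := by gcongr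
      _ = 2 * C * r := by
        rw [inv_pow, mul_pow]
        field_simp
        ring
  refine lt_of_lt_of_le ?_ this
  exact_mod_cast hr'

/-- The case of the origin: in the power series of `g` no pure power of `w` occurs, so every
homogeneous part is divisible by `z`. -/
theorem exists_analyticAt_fst_mul_zero {g : ℂ × ℂ → ℂ} (hg : AnalyticAt ℂ g 0)
    (h : ∀ᶠ w in 𝓝 (0 : ℂ), g (0, w) = 0) :
    ∃ k : ℂ × ℂ → ℂ, AnalyticAt ℂ k 0 ∧ ∀ᶠ q in 𝓝 (0 : ℂ × ℂ), g q = q.1 * k q := by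
  obtain ⟨p, hp⟩ := hg
  have hcoeff : ∀ n, monomialCoeff (p n) ∅ = 0 := fun n => by
    have hp' : HasFPowerSeriesAt g p (ContinuousLinearMap.inr ℂ ℂ ℂ 0) := by
      rw [map_zero]; exact hp
    have h1 := hp'.compContinuousLinearMap (u := ContinuousLinearMap.inr ℂ ℂ ℂ)
    have h2 := h1.eq_zero_of_eventually (by simpa [EventuallyEq, Function.comp] using h)
    have h3 : p.compContinuousLinearMap (ContinuousLinearMap.inr ℂ ℂ ℂ) n (fun _ => 1) = 0 := by
      rw [h2]; rfl
    refine Eq.trans (congrArg (p n) ?_) h3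
    ext i <;> simp
  have hrad := divFstSeries_radius_pos p hp.radius_pos
  have hq := (divFstSeries p).hasFPowerSeriesOnBall hrad
  refine ⟨(divFstSeries p).sum, hq.analyticAt, ?_⟩
  filter_upwards [hp.eventually_hasSum, hq.hasFPowerSeriesAt.eventually_hasSum] with y hy hy'
  rw [zero_add] at hy hy'
  have h0 : (p 0 fun _ => y) = 0 := by
    rw [apply_eq_sum_monomialCoeff]
    refine Finset.sum_eq_zero fun s _ => ?_
    rw [Finset.eq_empty_of_isEmpty s, hcoeff, mul_zero]
  have h1 := (hasSum_nat_add_iff' 1).2 hy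
  simp only [Finset.range_one, Finset.sum_singleton, h0, sub_zero] at h1
  have h2 := hy'.mul_left y.1
  simp_rw [fst_mul_divFstSeries p _ y (hcoeff _)] at h2
  exact h1.unique h2

/-- An analytic function of two variables which vanishes for `z = z₀` is divisible by `z - z₀`. -/
theorem exists_analyticAt_fst_sub_mul {g : ℂ × ℂ → ℂ} {p : ℂ × ℂ} (hg : AnalyticAt ℂ g p)
    (h : ∀ᶠ w in 𝓝 p.2, g (p.1, w) = 0) :
    ∃ k : ℂ × ℂ → ℂ, AnalyticAt ℂ k p ∧ ∀ᶠ q in 𝓝 p, g q = (q.1 - p.1) * k q := by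
  have hg0 : AnalyticAt ℂ (fun q => g (q + p)) 0 :=
    AnalyticAt.fun_comp (f := fun q => q + p) (by simpa using hg) (by fun_prop)
  have ht : Tendsto (fun w : ℂ => w + p.2) (𝓝 0) (𝓝 p.2) := by
    have : Continuous fun w : ℂ => w + p.2 := by fun_prop
    simpa using this.tendsto 0
  obtain ⟨k, hk, hgk⟩ := exists_analyticAt_fst_mul_zero hg0 (by
    filter_upwards [ht.eventually h] with w hw
    simpa [Prod.add_def] using hw)
  refine ⟨fun q => k (q - p), AnalyticAt.fun_comp (f := fun q => q - p) (by simpa using hk)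
    (by fun_prop), ?_⟩
  have ht' : Tendsto (fun q : ℂ × ℂ => q - p) (𝓝 p) (𝓝 0) := by
    have : Continuous fun q : ℂ × ℂ => q - p := by fun_prop
    simpa using this.tendsto p
  filter_upwards [ht'.eventually hgk] with q hq
  simpa using hq

/-! ### Expansion along the curve `{0} × E` -/

variable {P : PeriodPair}

theorem mem_regularLocus {z w : ℂ} : (proj P z, proj P w) ∈ regularLocus P ↔
    z ∉ P.lattice ∧ w ∉ P.lattice ∧ z - w ∉ P.lattice := by
  simp only [regularLocus, Set.mem_ofPred_eq, ne_eq, proj_eq_zero]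
  rw [proj, proj, Submodule.Quotient.eq]

open Classical in
/-- The function on `ℂ × ℂ` given by `f`, extended by zero to the preimage of the three curves. -/
def lift (f : regularLocus P → ℂ) (z w : ℂ) : ℂ :=
  if h : (proj P z, proj P w) ∈ regularLocus P then f ⟨_, h⟩ else 0

theorem lift_of_mem (f : regularLocus P → ℂ) {z w : ℂ}
    (h : (proj P z, proj P w) ∈ regularLocus P) : lift f z w = f ⟨_, h⟩ := dif_pos h

theorem lift_add_left (f : regularLocus P → ℂ) {l : ℂ} (hl : l ∈ P.lattice) (z w : ℂ) :
    lift f (z + l) w = lift f z w := by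
  classical
  exact congrArg (fun x => if h : (x, proj P w) ∈ regularLocus P then f ⟨_, h⟩ else 0)
    (proj_add_period hl z)

theorem lift_add_right (f : regularLocus P → ℂ) {l : ℂ} (hl : l ∈ P.lattice) (z w : ℂ) :
    lift f z (w + l) = lift f z w := by
  classical
  exact congrArg (fun y => if h : (proj P z, y) ∈ regularLocus P then f ⟨_, h⟩ else 0)
    (proj_add_period hl w)

theorem lift_sub (f f' : regularLocus P → ℂ) (z w : ℂ) :
    lift (f - f') z w = lift f z w - lift f' z w := by
  unfold lift
  split_ifs <;> simp

theorem lift_add (f f' : regularLocus P → ℂ) (z w : ℂ) :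
    lift (f + f') z w = lift f z w + lift f' z w := by
  unfold lift
  split_ifs <;> simp

theorem lift_smul (c : ℂ) (f : regularLocus P → ℂ) (z w : ℂ) :
    lift (c • f) z w = c * lift f z w := by
  unfold lift
  split_ifs <;> simp

theorem lift_mul (f f' : regularLocus P → ℂ) (z w : ℂ) :
    lift (f * f') z w = lift f z w * lift f' z w := by
  unfold lift
  split_ifs <;> simp

theorem continuous_localEq (z₀ : ℂ) : Continuous (localEq P z₀) := by
  unfold localEq
  split_ifs <;> fun_prop

theorem localEq_of_mem {z₀ : ℂ} (h : z₀ ∈ P.lattice) (z : ℂ) : localEq P z₀ z = z - z₀ := if_pos h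

theorem localEq_of_notMem {z₀ : ℂ} (h : z₀ ∉ P.lattice) (z : ℂ) : localEq P z₀ z = 1 := if_neg h

open Classical in
/-- The sign by which the local equation of the lattice changes under `z ↦ -z`. -/
def localSign (P : PeriodPair) (z₀ : ℂ) : ℂ := if z₀ ∈ P.lattice then -1 else 1

theorem localSign_mul_self (z₀ : ℂ) : localSign P z₀ * localSign P z₀ = 1 := by
  unfold localSign
  split_ifs <;> norm_num

theorem localEq_neg (z₀ z : ℂ) : localEq P (-z₀) (-z) = localSign P z₀ * localEq P z₀ z := by
  by_cases h : z₀ ∈ P.lattice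
  · rw [localEq_of_mem (neg_mem h), localEq_of_mem h, localSign, if_pos h]
    ring
  · rw [localEq_of_notMem (by simpa using h), localEq_of_notMem h, localSign, if_neg h, one_mul]

/-- `h(w)` is the coefficient of `z⁻ᵏ` in the expansion of `f` along the curve `{0} × E`, where `f`
has a pole of order at most `k`. -/
def LeadingCoeff (k : ℕ) (f : regularLocus P → ℂ) (h : ℂ → ℂ) : Prop :=
  ∀ w ∉ P.lattice, Tendsto (fun z => z ^ k * lift f z w) (𝓝[≠] 0) (𝓝 (h w))

/-- The function `g` that extends `f` times the local equation of the divisor near a point of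
`{l} × E`, with `l` a lattice point, is determined on the line `z = l` by the behaviour of `f` as
`z → l`, for `w` off the lattice. -/
theorem tendsto_slice {f : regularLocus P → ℂ} {k b c : ℕ} {p : ℂ × ℂ} (hp : p.1 ∈ P.lattice)
    {g : ℂ × ℂ → ℂ} (hg : AnalyticAt ℂ g p)
    (h : ∀ᶠ q in 𝓝 p, ∀ hq : (proj P q.1, proj P q.2) ∈ regularLocus P,
      f ⟨(proj P q.1, proj P q.2), hq⟩ * divisorEq P k b c p q = g q) :
    ∀ᶠ w in 𝓝 p.2, w ∉ P.lattice →
      Tendsto (fun z => (z - p.1) ^ k * lift f z w *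
        (localEq P p.2 w ^ b * localEq P (p.1 - p.2) (z - w) ^ c)) (𝓝[≠] p.1)
        (𝓝 (g (p.1, w))) := by
  have hline : Tendsto (fun w : ℂ => (p.1, w)) (𝓝 p.2) (𝓝 p) :=
    (by fun_prop : Continuous fun w : ℂ => (p.1, w)).tendsto p.2
  filter_upwards [hline.eventually (h.eventually_nhds.and hg.eventually_analyticAt)] with
    w ⟨hw, hwg⟩ hwl
  have hrow : Tendsto (fun z : ℂ => (z, w)) (𝓝[≠] p.1) (𝓝 (p.1, w)) :=
    ((by fun_prop : Continuous fun z : ℂ => (z, w)).tendsto p.1).mono_left nhdsWithin_le_nhds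
  refine (hwg.continuousAt.tendsto.comp hrow).congr' ?_
  have hd : p.1 - w ∉ P.lattice := fun hmem => hwl (by simpa using sub_mem hp hmem)
  have hdw : ∀ᶠ z in 𝓝[≠] p.1, z - w ∉ P.lattice :=
    (((by fun_prop : Continuous fun z : ℂ => z - w).tendsto p.1).eventually
      (lattice_compl_mem_nhds hd)).filter_mono nhdsWithin_le_nhds
  filter_upwards [hrow.eventually hw, hdw, eventually_notMem_lattice P p.1] with z hz hzw hzl
  have hm : (proj P z, proj P w) ∈ regularLocus P := mem_regularLocus.2 ⟨hzl, hwl, hzw⟩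
  rw [Function.comp, ← hz hm, lift_of_mem f hm, divisorEq, localEq_of_mem hp]
  ring

theorem LeadingCoeff.tendsto_period {k : ℕ} {f : regularLocus P → ℂ} {h : ℂ → ℂ}
    (hf : LeadingCoeff k f h) {l : ℂ} (hl : l ∈ P.lattice) {w : ℂ} (hw : w ∉ P.lattice) :
    Tendsto (fun z => (z - l) ^ k * lift f z w) (𝓝[≠] l) (𝓝 (h w)) := by
  have ht : Tendsto (fun z => z - l) (𝓝[≠] l) (𝓝[≠] 0) := by
    have : Tendsto (fun z => z - l) (𝓝[≠] l) (𝓝[≠] (l - l)) :=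
      (by fun_prop : Continuous fun z : ℂ => z - l).continuousWithinAt.tendsto_nhdsWithin
        fun z hz h => hz (sub_left_inj.1 h)
    rwa [sub_self] at this
  refine ((hf w hw).comp ht).congr fun z => ?_
  rw [Function.comp, sub_eq_add_neg, lift_add_left f (neg_mem hl)]

theorem continuous_localEq_sub (z₀ w : ℂ) (c : ℕ) :
    Continuous fun z => localEq P z₀ (z - w) ^ c :=
  ((continuous_localEq z₀).comp (by fun_prop)).pow c

/-- A function whose leading coefficient along `{0} × E` vanishes has a pole of lower order. -/
theorem HasPolesLE.of_leadingCoeff_zero {f : regularLocus P → ℂ} {k b c : ℕ}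
    (hf : HasPolesLE P (k + 1) b c f) (h0 : LeadingCoeff (k + 1) f fun _ => 0) :
    HasPolesLE P k b c f := by
  intro p
  obtain ⟨g, hg, h⟩ := hf p
  by_cases hp : p.1 ∈ P.lattice
  · have hzero : ∀ᶠ w in 𝓝 p.2, w ∉ P.lattice → g (p.1, w) = 0 := by
      filter_upwards [tendsto_slice hp hg h] with w hw hwl
      have h1 := (h0.tendsto_period hp hwl).mul
        (tendsto_const_nhds (x := localEq P p.2 w ^ b) |>.mul
        (((continuous_localEq_sub (P := P) (p.1 - p.2) w c).tendsto p.1).mono_left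
          (nhdsWithin_le_nhds (s := {p.1}ᶜ))))
      rw [zero_mul] at h1
      exact tendsto_nhds_unique (hw hwl) h1
    have hline : Tendsto (fun w : ℂ => (p.1, w)) (𝓝 p.2) (𝓝 p) :=
      (by fun_prop : Continuous fun w : ℂ => (p.1, w)).tendsto p.2
    have hzero' : ∀ᶠ w in 𝓝[≠] p.2, g (p.1, w) = 0 := by
      filter_upwards [hzero.filter_mono nhdsWithin_le_nhds, eventually_notMem_lattice P p.2]
        with w hw hwl using hw hwl
    have hgp : g (p.1, p.2) = 0 :=
      tendsto_nhds_unique ((hg.continuousAt.tendsto.comp hline).mono_left nhdsWithin_le_nhds)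
        (tendsto_const_nhds.congr' (by
          filter_upwards [hzero'] with w hw using hw.symm))
    have hall : ∀ᶠ w in 𝓝 p.2, g (p.1, w) = 0 := by
      filter_upwards [eventually_nhdsWithin_iff.1 hzero'] with w hw
      by_cases hwp : w = p.2
      · rw [hwp, hgp]
      · exact hw hwp
    obtain ⟨g', hg', hgg'⟩ := exists_analyticAt_fst_sub_mul hg hall
    refine ⟨g', hg', ?_⟩
    filter_upwards [h, hgg'] with q hq hq' hm
    have hne : q.1 - p.1 ≠ 0 := fun h1 => (mem_regularLocus.1 hm).1 (by
      rw [sub_eq_zero.1 h1]; exact hp)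
    have h1 := hq hm
    rw [hq'] at h1
    apply mul_left_cancel₀ hne
    rw [← h1]
    simp only [divisorEq, localEq_of_mem hp]
    ring
  · refine ⟨g, hg, ?_⟩
    filter_upwards [h] with q hq hm
    rw [← hq hm]
    simp only [divisorEq, localEq_of_notMem hp, one_pow]

/-- The leading coefficient along `{0} × E` of a function in `L(k, b, c)` is an elliptic function
with a pole of order at most `b + c`: the curves `E × {0}` and the diagonal both meet `{0} × E` only
in the origin. -/
theorem HasPolesLE.exists_leadingCoeff {f : regularLocus P → ℂ} {k b c : ℕ}
    (hf : HasPolesLE P k b c f) :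
    ∃ h, LeadingCoeff k f h ∧ PoleLE P (b + c) h ∧ ∀ w ∉ P.lattice, AnalyticAt ℂ h w := by
  have hex : ∀ w, ∃ y, w ∉ P.lattice →
      Tendsto (fun z => z ^ k * lift f z w) (𝓝[≠] 0) (𝓝 y) := fun w => by
    by_cases hw : w ∈ P.lattice
    · exact ⟨0, fun h => absurd hw h⟩
    obtain ⟨g, hg, h⟩ := hf (0, w)
    refine ⟨g (0, w), fun _ => ?_⟩
    have := (tendsto_slice (zero_mem _) hg h).self_of_nhds hw
    simpa [localEq_of_notMem hw, localEq_of_notMem (P := P) (z₀ := -w) (by simpa using hw)]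
      using this
  choose h₀ hh₀ using hex
  classical
  set h : ℂ → ℂ := fun w => if w ∈ P.lattice then 0 else h₀ w with hh
  have hlc : LeadingCoeff k f h := fun w hw => by
    simp only [hh, if_neg hw]
    exact hh₀ w hw
  have hloc : ∀ w₀, ∃ G : ℂ → ℂ, AnalyticAt ℂ G w₀ ∧ ∀ᶠ w in 𝓝 w₀, w ∉ P.lattice →
      h w * localEq P w₀ w ^ (b + c) = G w := fun w₀ => by
    obtain ⟨g, hg, hfg⟩ := hf (0, w₀)
    refine ⟨fun w => localSign P w₀ ^ c * g (0, w), ?_, ?_⟩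
    · refine analyticAt_const.mul (AnalyticAt.fun_comp (f := fun w : ℂ => ((0 : ℂ), w)) hg ?_)
      fun_prop
    · filter_upwards [tendsto_slice (zero_mem _) hg hfg] with w hw hwl
      have h1 := (hlc.tendsto_period (zero_mem _) hwl).mul
        (tendsto_const_nhds (x := localEq P w₀ w ^ b) |>.mul
        (((continuous_localEq_sub (P := P) (0 - w₀) w c).tendsto 0).mono_left
          (nhdsWithin_le_nhds (s := {0}ᶜ))))
      have h2 := tendsto_nhds_unique (hw hwl) h1
      simp only [zero_sub, localEq_neg] at h2
      rw [h2, mul_pow]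
      have h3 : localSign P w₀ ^ c * localSign P w₀ ^ c = 1 := by
        rw [← mul_pow, localSign_mul_self, one_pow]
      rw [pow_add]
      linear_combination (-(h w * localEq P w₀ w ^ b * localEq P w₀ w ^ c)) * h3
  have hana : ∀ w ∉ P.lattice, AnalyticAt ℂ h w := fun w₀ hw₀ => by
    obtain ⟨G, hG, hGh⟩ := hloc w₀
    refine hG.congr ?_
    filter_upwards [hGh, lattice_compl_mem_nhds hw₀] with w hw hwl
    rw [← hw hwl, localEq_of_notMem hw₀, one_pow, mul_one]
  have hon : ∀ w₀ ∈ P.lattice, ∃ G : ℂ → ℂ, AnalyticAt ℂ G w₀ ∧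
      ∀ᶠ w in 𝓝[≠] w₀, h w * (w - w₀) ^ (b + c) = G w := fun w₀ hw₀ => by
    obtain ⟨G, hG, hGh⟩ := hloc w₀
    refine ⟨G, hG, ?_⟩
    filter_upwards [hGh.filter_mono nhdsWithin_le_nhds, eventually_notMem_lattice P w₀] with w hw hwl
    rw [← hw hwl, localEq_of_mem hw₀]
  have hmero : Meromorphic h := fun w => by
    by_cases hw : w ∈ P.lattice
    · obtain ⟨G, hG, hGh⟩ := hon w hw
      exact meromorphicAt_of_mul_pow hG hGh
    · exact (hana w hw).meromorphicAt
  refine ⟨h, hlc, ⟨hmero, fun l hl w => ?_, fun w hw => (hana w hw).meromorphicOrderAt_nonneg,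
    (neg_natCast_le_order_iff (hmero 0) _).2 (hon 0 (zero_mem _))⟩, hana⟩
  by_cases hw : w ∈ P.lattice
  · simp only [hh, if_pos hw, if_pos (add_mem hw hl)]
  · have hwl : w + l ∉ P.lattice := fun h1 => hw (by simpa using sub_mem h1 hl)
    have h1 := hlc _ hwl
    simp only [lift_add_right f hl] at h1
    exact tendsto_nhds_unique h1 (hlc w hw)

theorem LeadingCoeff.mono {f : regularLocus P → ℂ} {h : ℂ → ℂ} {k : ℕ}
    (hf : LeadingCoeff k f h) : LeadingCoeff (k + 1) f fun _ => 0 := fun w hw => by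
  have h1 : Tendsto (fun z : ℂ => z) (𝓝[≠] 0) (𝓝 0) := tendsto_id.mono_left nhdsWithin_le_nhds
  have h2 := h1.mul (hf w hw)
  rw [zero_mul] at h2
  exact h2.congr fun z => by ring

/-- If a function in `L(m, b, c)` has an expansion along `{0} × E` beginning with `z⁻ᵏ`, then it
belongs to `L(k, b, c)`. -/
theorem HasPolesLE.of_leadingCoeff {f : regularLocus P → ℂ} {h : ℂ → ℂ} {k m b c : ℕ}
    (hkm : k ≤ m) (hf : HasPolesLE P m b c f) (hlc : LeadingCoeff k f h) :
    HasPolesLE P k b c f := by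
  obtain ⟨d, rfl⟩ := Nat.exists_eq_add_of_le hkm
  have key : ∀ j, ∃ h', LeadingCoeff (k + j) f h' := fun j => by
    induction j with
    | zero => exact ⟨h, hlc⟩
    | succ j ih =>
      obtain ⟨h', hh'⟩ := ih
      exact ⟨_, hh'.mono⟩
  clear hkm
  induction d with
  | zero => exact hf
  | succ d ih =>
    obtain ⟨h', hh'⟩ := key d
    exact ih (HasPolesLE.of_leadingCoeff_zero hf hh'.mono)

theorem HasPolesLE.mono_left {f : regularLocus P → ℂ} {k m b c : ℕ} (hkm : k ≤ m)
    (hf : HasPolesLE P k b c f) : HasPolesLE P m b c f := by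
  obtain ⟨d, rfl⟩ := Nat.exists_eq_add_of_le hkm
  have h1 : HasPolesLE P d 0 0 (1 : regularLocus P → ℂ) := fun p =>
    ⟨fun q => localEq P p.1 q.1 ^ d, by
      unfold localEq
      split_ifs
      · exact (analyticAt_fst.sub analyticAt_const).pow d
      · fun_prop, Eventually.of_forall fun q _ => by simp [divisorEq]⟩
  simpa using hf.mul h1

/-! ### Products of `1, ℘, ℘', ℘''` on `E × E` and symmetries -/

/-- Each of `1, ℘, ℘', ℘''` has a pole of order at most `4` along the lattice. -/
theorem exists_rowFun_mul_localEq (P : PeriodPair) (j : Fin 4) (z₀ : ℂ) :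
    ∃ g : ℂ → ℂ, AnalyticAt ℂ g z₀ ∧ ∀ᶠ z in 𝓝 z₀, z ∉ P.lattice →
      rowFun P j z * localEq P z₀ z ^ 4 = g z := by
  by_cases hz : z₀ ∈ P.lattice
  · have ho : ((-((4 : ℕ) : ℤ) : ℤ) : WithTop ℤ) ≤ meromorphicOrderAt (rowFun P j) z₀ := by
      have := order_add_period (h := rowFun P j) (fun l hl z => rowFun_add_period j hl z) hz 0
      rw [zero_add] at this
      rw [this, order_rowFun]
      norm_cast
      have : rowOrder j ≤ 4 := by fin_cases j <;> simp [rowOrder]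
      omega
    obtain ⟨g, hg, h⟩ := (neg_natCast_le_order_iff (meromorphic_rowFun P j z₀) 4).1 ho
    refine ⟨g, hg, ?_⟩
    filter_upwards [eventually_nhdsWithin_iff.1 h] with z hz' hzl
    rw [localEq_of_mem hz]
    exact hz' fun h1 => hzl (by rw [h1]; exact hz)
  · refine ⟨rowFun P j, analyticAt_rowFun j hz, Eventually.of_forall fun z _ => ?_⟩
    rw [localEq_of_notMem hz, one_pow, mul_one]

/-- `1, ℘, ℘', ℘''` as functions of the first variable. -/
def rowFst (P : PeriodPair) (j : Fin 4) : poleSpace P 4 0 0 :=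
  ⟨fun x => row P j x.1.1, fun p => by
    obtain ⟨g, hg, h⟩ := exists_rowFun_mul_localEq P j p.1
    refine ⟨fun q => g q.1, hg.fun_comp analyticAt_fst, ?_⟩
    filter_upwards [(continuous_fst.tendsto p).eventually h] with q hq hm
    rw [← hq (mem_regularLocus.1 hm).1, divisorEq, pow_zero, pow_zero, mul_one, mul_one]
    rfl⟩

/-- `1, ℘, ℘', ℘''` as functions of the second variable. -/
def rowSnd (P : PeriodPair) (j : Fin 4) : poleSpace P 0 4 0 :=
  ⟨fun x => row P j x.1.2, fun p => by
    obtain ⟨g, hg, h⟩ := exists_rowFun_mul_localEq P j p.2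
    refine ⟨fun q => g q.2, hg.fun_comp analyticAt_snd, ?_⟩
    filter_upwards [(continuous_snd.tendsto p).eventually h] with q hq hm
    rw [← hq (mem_regularLocus.1 hm).2.1, divisorEq, pow_zero, pow_zero, mul_one, one_mul]
    rfl⟩

/-- `1, ℘, ℘', ℘''` as functions of the difference of the variables. -/
def rowDiff (P : PeriodPair) (j : Fin 4) : poleSpace P 0 0 4 :=
  ⟨fun x => row P j (x.1.1 - x.1.2), fun p => by
    obtain ⟨g, hg, h⟩ := exists_rowFun_mul_localEq P j (p.1 - p.2)
    refine ⟨fun q => g (q.1 - q.2), AnalyticAt.fun_comp (f := fun q : ℂ × ℂ => q.1 - q.2) hg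
      (analyticAt_fst.sub analyticAt_snd), ?_⟩
    filter_upwards [((by fun_prop : Continuous fun q : ℂ × ℂ => q.1 - q.2).tendsto p).eventually h]
      with q hq hm
    rw [← hq (mem_regularLocus.1 hm).2.2, divisorEq, pow_zero, pow_zero, one_mul, one_mul]
    rfl⟩

theorem weierstrassProduct_eq_mulMap (P : PeriodPair) {a b c : ℕ} (i : Fin a → Fin 4)
    (j : Fin b → Fin 4) (k : Fin c → Fin 4) :
    weierstrassProduct P i j k = (mulMap P a b c
      ((PiTensorProduct.tprod ℂ (fun r => rowFst P (i r)) ⊗ₜ[ℂ]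
        PiTensorProduct.tprod ℂ (fun r => rowSnd P (j r))) ⊗ₜ[ℂ]
        PiTensorProduct.tprod ℂ (fun r => rowDiff P (k r))) : regularLocus P → ℂ) := by
  rw [mulMap_tprod]
  ext x
  simp only [Pi.mul_apply, Finset.prod_apply]
  rfl

theorem weierstrassSpan_le_range (P : PeriodPair) (a b c : ℕ) :
    weierstrassSpan P a b c ≤ LinearMap.range (mulMapAux P a b c) := by
  refine Submodule.span_le.2 ?_
  rintro _ ⟨i, j, k, rfl⟩
  rw [weierstrassProduct_eq_mulMap]
  exact ⟨_, rfl⟩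

theorem weierstrassSpan_le_poleSpace (P : PeriodPair) (a b c : ℕ) :
    weierstrassSpan P a b c ≤ poleSpace P (4 * a) (4 * b) (4 * c) := by
  intro f hf
  obtain ⟨t, rfl⟩ := weierstrassSpan_le_range P a b c hf
  exact mulMapAux_mem P a b c t

theorem weierstrassProduct_mem (P : PeriodPair) {a b c : ℕ} (i : Fin a → Fin 4)
    (j : Fin b → Fin 4) (k : Fin c → Fin 4) :
    weierstrassProduct P i j k ∈ weierstrassSpan P a b c :=
  Submodule.subset_span ⟨i, j, k, rfl⟩

theorem mul_mem_weierstrassSpan {a b c a' b' c' : ℕ} {f f' : regularLocus P → ℂ}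
    (hf : f ∈ weierstrassSpan P a b c) (hf' : f' ∈ weierstrassSpan P a' b' c') :
    f * f' ∈ weierstrassSpan P (a + a') (b + b') (c + c') := by
  have h := Submodule.mul_mem_mul hf hf'
  rw [weierstrassSpan, weierstrassSpan, Submodule.span_mul_span] at h
  refine Submodule.span_le.2 ?_ h
  rintro _ ⟨_, ⟨i, j, k, rfl⟩, _, ⟨i', j', k', rfl⟩, rfl⟩
  have := weierstrassProduct_mem P (Fin.append i i') (Fin.append j j') (Fin.append k k')
  refine Set.mem_of_eq_of_mem ?_ this
  ext x
  simp only [weierstrassProduct, Pi.mul_apply, Fin.prod_univ_add, Fin.append_left, Fin.append_right]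
  ring

theorem one_mem_weierstrassSpan (a b c : ℕ) :
    (1 : regularLocus P → ℂ) ∈ weierstrassSpan P a b c := by
  convert weierstrassProduct_mem P (a := a) (b := b) (c := c) (fun _ => 0) (fun _ => 0)
    (fun _ => 0) using 1
  ext x
  simp [weierstrassProduct, row]

theorem weierstrassSpan_mono {a b c a' b' c' : ℕ} (ha : a ≤ a') (hb : b ≤ b') (hc : c ≤ c') :
    weierstrassSpan P a b c ≤ weierstrassSpan P a' b' c' := by
  obtain ⟨a, rfl⟩ := Nat.exists_eq_add_of_le ha
  obtain ⟨b, rfl⟩ := Nat.exists_eq_add_of_le hb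
  obtain ⟨c, rfl⟩ := Nat.exists_eq_add_of_le hc
  intro f hf
  simpa using mul_mem_weierstrassSpan hf (one_mem_weierstrassSpan (P := P) a b c)

/-- The automorphism `(z, w) ↦ (w - z, w)` of `E × E`, which exchanges `{0} × E` with the
diagonal. -/
def swapDiag (x : regularLocus P) : regularLocus P :=
  ⟨(x.1.2 - x.1.1, x.1.2), sub_ne_zero.2 x.2.2.2.symm, x.2.2.1, fun h => x.2.1 (by
    simpa using h)⟩

/-- The automorphism `(z, w) ↦ (z, z - w)` of `E × E`, which exchanges `E × {0}` with the
diagonal. -/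
def swapSnd (x : regularLocus P) : regularLocus P :=
  ⟨(x.1.1, x.1.1 - x.1.2), x.2.1, sub_ne_zero.2 x.2.2.2, fun h =>
    x.2.2.1 (sub_eq_self.1 h.symm)⟩

theorem swapDiag_swapDiag (x : regularLocus P) : swapDiag (swapDiag x) = x := by
  simp [swapDiag]

theorem swapSnd_swapSnd (x : regularLocus P) : swapSnd (swapSnd x) = x := by
  simp [swapSnd]

theorem HasPolesLE.comp_swapSnd {f : regularLocus P → ℂ} {a b c : ℕ} (hf : HasPolesLE P a b c f) :
    HasPolesLE P a c b (f ∘ swapSnd) := by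
  intro p
  obtain ⟨g, hg, h⟩ := hf (p.1, p.1 - p.2)
  refine ⟨fun q => g (q.1, q.1 - q.2), AnalyticAt.fun_comp
    (f := fun q : ℂ × ℂ => (q.1, q.1 - q.2)) hg
    (analyticAt_fst.prod (analyticAt_fst.sub analyticAt_snd)), ?_⟩
  filter_upwards [((by fun_prop : Continuous fun q : ℂ × ℂ => (q.1, q.1 - q.2)).tendsto
    p).eventually h] with q hq hm
  obtain ⟨h1, h2, h3⟩ := mem_regularLocus.1 hm
  rw [← hq (mem_regularLocus.2 ⟨h1, h3, by simpa using h2⟩)]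
  simp only [divisorEq, sub_sub_cancel, Function.comp]
  rw [mul_right_comm]
  rfl

theorem HasPolesLE.comp_swapDiag {f : regularLocus P → ℂ} {a b c : ℕ} (hf : HasPolesLE P a b c f) :
    HasPolesLE P c b a (f ∘ swapDiag) := by
  intro p
  obtain ⟨g, hg, h⟩ := hf (p.2 - p.1, p.2)
  refine ⟨fun q => localSign P (p.1 - p.2) ^ a * localSign P p.1 ^ c * g (q.2 - q.1, q.2),
    analyticAt_const.mul (AnalyticAt.fun_comp
    (f := fun q : ℂ × ℂ => (q.2 - q.1, q.2)) hg
    ((analyticAt_snd.sub analyticAt_fst).prod analyticAt_snd)), ?_⟩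
  filter_upwards [((by fun_prop : Continuous fun q : ℂ × ℂ => (q.2 - q.1, q.2)).tendsto
    p).eventually h] with q hq hm
  obtain ⟨h1, h2, h3⟩ := mem_regularLocus.1 hm
  rw [← hq (mem_regularLocus.2 ⟨by simpa using neg_mem_iff.not.2 h3, h2, by simpa using h1⟩)]
  simp only [divisorEq, Function.comp]
  have d1 : localEq P (p.2 - p.1) (q.2 - q.1) =
      localSign P (p.1 - p.2) * localEq P (p.1 - p.2) (q.1 - q.2) := by
    rw [← localEq_neg, neg_sub, neg_sub]
  have d2 : localEq P (p.2 - p.1 - p.2) (q.2 - q.1 - q.2) =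
      localSign P p.1 * localEq P p.1 q.1 := by
    rw [← localEq_neg, sub_sub_cancel_left, sub_sub_cancel_left]
  have e1 : localSign P (p.1 - p.2) ^ a * localSign P (p.1 - p.2) ^ a = 1 := by
    rw [← mul_pow, localSign_mul_self, one_pow]
  have e2 : localSign P p.1 ^ c * localSign P p.1 ^ c = 1 := by
    rw [← mul_pow, localSign_mul_self, one_pow]
  rw [d1, d2, mul_pow, mul_pow]
  set x := localEq P p.1 q.1 ^ c
  set y := localEq P p.2 q.2 ^ b
  set t := localEq P (p.1 - p.2) (q.1 - q.2) ^ a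
  set s := localSign P (p.1 - p.2) ^ a
  set s' := localSign P p.1 ^ c
  change f (swapDiag ⟨(proj P q.1, proj P q.2), hm⟩) * _ =
    _ * (f (swapDiag ⟨(proj P q.1, proj P q.2), hm⟩) * _)
  set F := f (swapDiag ⟨(proj P q.1, proj P q.2), hm⟩)
  linear_combination (-(F * x * y * t * s' * s')) * e1 - F * x * y * t * e2

theorem comp_swapSnd_mem {f : regularLocus P → ℂ} {a b c : ℕ} (hf : f ∈ weierstrassSpan P a b c) :
    f ∘ swapSnd ∈ weierstrassSpan P a c b := by
  induction hf using Submodule.span_induction with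
  | mem x hx =>
    obtain ⟨i, j, k, rfl⟩ := hx
    convert weierstrassProduct_mem P i k j using 1
    ext x
    simp only [weierstrassProduct, swapSnd, Function.comp, sub_sub_cancel]
    ring
  | zero => exact zero_mem _
  | add x y _ _ hx hy => exact add_mem hx hy
  | smul r x _ hx => exact Submodule.smul_mem _ r hx

theorem comp_swapDiag_mem {f : regularLocus P → ℂ} {a b c : ℕ} (hf : f ∈ weierstrassSpan P a b c) :
    f ∘ swapDiag ∈ weierstrassSpan P c b a := by
  induction hf using Submodule.span_induction with
  | mem x hx =>
    obtain ⟨i, j, k, rfl⟩ := hx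
    convert Submodule.smul_mem _ ((∏ r, rowSign (i r)) * ∏ r, rowSign (k r))
      (weierstrassProduct_mem P k j i) using 1
    ext x
    simp only [weierstrassProduct, swapDiag, Function.comp, Pi.smul_apply, smul_eq_mul]
    have e1 : ∏ r, row P (i r) (x.1.2 - x.1.1) =
        (∏ r, rowSign (i r)) * ∏ r, row P (i r) (x.1.1 - x.1.2) := by
      rw [← Finset.prod_mul_distrib]
      exact Finset.prod_congr rfl fun r _ => by rw [← row_neg, neg_sub]
    have e2 : ∏ r, row P (k r) (x.1.2 - x.1.1 - x.1.2) =
        (∏ r, rowSign (k r)) * ∏ r, row P (k r) x.1.1 := by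
      rw [← Finset.prod_mul_distrib]
      exact Finset.prod_congr rfl fun r _ => by rw [← row_neg]; congr 1; abel
    rw [e1, e2]
    ring
  | zero => exact zero_mem _
  | add x y _ _ hx hy => exact add_mem hx hy
  | smul r x _ hx => exact Submodule.smul_mem _ r hx

/-! ### Leading coefficients of the products -/

theorem eventually_mem_regularLocus {w : ℂ} (hw : w ∉ P.lattice) (z₀ : ℂ) :
    ∀ᶠ z in 𝓝[≠] z₀, (proj P z, proj P w) ∈ regularLocus P := by
  have ht : Tendsto (fun z => z - w) (𝓝[≠] z₀) (𝓝[≠] (z₀ - w)) :=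
    (by fun_prop : Continuous fun z : ℂ => z - w).continuousWithinAt.tendsto_nhdsWithin
      fun z hz h => hz (sub_left_inj.1 h)
  filter_upwards [eventually_notMem_lattice P z₀,
    ht.eventually (eventually_notMem_lattice P (z₀ - w))] with z h1 h2
  exact mem_regularLocus.2 ⟨h1, hw, h2⟩

theorem LeadingCoeff.of_lift_eq {k : ℕ} {f : regularLocus P → ℂ} {F : ℂ → ℂ → ℂ} {h : ℂ → ℂ}
    (hF : ∀ z w, (proj P z, proj P w) ∈ regularLocus P → lift f z w = F z w)
    (ht : ∀ w ∉ P.lattice, Tendsto (fun z => z ^ k * F z w) (𝓝[≠] 0) (𝓝 (h w))) :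
    LeadingCoeff k f h := fun w hw => by
  refine (ht w hw).congr' ?_
  filter_upwards [eventually_mem_regularLocus hw 0] with z hz
  rw [hF z w hz]

theorem LeadingCoeff.add {k : ℕ} {f f' : regularLocus P → ℂ} {h h' : ℂ → ℂ}
    (hf : LeadingCoeff k f h) (hf' : LeadingCoeff k f' h') :
    LeadingCoeff k (f + f') (h + h') := fun w hw =>
  ((hf w hw).add (hf' w hw)).congr fun z => by rw [lift_add]; ring

theorem LeadingCoeff.sub {k : ℕ} {f f' : regularLocus P → ℂ} {h h' : ℂ → ℂ}
    (hf : LeadingCoeff k f h) (hf' : LeadingCoeff k f' h') :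
    LeadingCoeff k (f - f') (h - h') := fun w hw =>
  ((hf w hw).sub (hf' w hw)).congr fun z => by rw [lift_sub]; ring

theorem LeadingCoeff.smul {k : ℕ} {f : regularLocus P → ℂ} {h : ℂ → ℂ} (r : ℂ)
    (hf : LeadingCoeff k f h) : LeadingCoeff k (r • f) (r • h) := fun w hw =>
  ((hf w hw).const_mul r).congr fun z => by rw [lift_smul]; ring

theorem LeadingCoeff.congr {k : ℕ} {f : regularLocus P → ℂ} {h h' : ℂ → ℂ}
    (hf : LeadingCoeff k f h) (hh : ∀ w ∉ P.lattice, h' w = h w) : LeadingCoeff k f h' :=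
  fun w hw => by rw [hh w hw]; exact hf w hw

/-- The functions that occur as coefficients of `z⁻ᵏ` along `{0} × E` of elements of `M(4a, 4b, 4c)`
which have a pole of order at most `k` there. -/
def leadingSpace (P : PeriodPair) (a b c k : ℕ) : Submodule ℂ (ℂ → ℂ) where
  carrier := {h | ∃ f ∈ weierstrassSpan P a b c, LeadingCoeff k f h}
  zero_mem' := ⟨0, zero_mem _, fun w _ => by simp [lift]⟩
  add_mem' := fun ⟨f, hf, h⟩ ⟨f', hf', h'⟩ => ⟨f + f', add_mem hf hf', h.add h'⟩
  smul_mem' := fun r _ ⟨f, hf, h⟩ => ⟨r • f, Submodule.smul_mem _ r hf, h.smul r⟩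

theorem leadingSpace_congr {a b c k : ℕ} {h h' : ℂ → ℂ} (hh : h ∈ leadingSpace P a b c k)
    (e : ∀ w ∉ P.lattice, h' w = h w) : h' ∈ leadingSpace P a b c k := by
  obtain ⟨f, hf, hfh⟩ := hh
  exact ⟨f, hf, hfh.congr e⟩

theorem lift_weierstrassProduct {a b c : ℕ} (i : Fin a → Fin 4) (j : Fin b → Fin 4)
    (k : Fin c → Fin 4) {z w : ℂ} (h : (proj P z, proj P w) ∈ regularLocus P) :
    lift (weierstrassProduct P i j k) z w =
      (∏ r, rowFun P (i r) z) * (∏ r, rowFun P (j r) w) * ∏ r, rowFun P (k r) (z - w) :=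
  lift_of_mem _ h

/-- Multiplication by a function without a pole along `{0} × E`. -/
theorem LeadingCoeff.mul_weierstrassProduct {κ b c : ℕ} {f : regularLocus P → ℂ} {h : ℂ → ℂ}
    (hf : LeadingCoeff κ f h) (i : Fin 0 → Fin 4) (j : Fin b → Fin 4) (k : Fin c → Fin 4) :
    LeadingCoeff κ (f * weierstrassProduct P i j k) fun w =>
      h w * ((∏ r, rowFun P (j r) w) * ∏ r, rowFun P (k r) (-w)) := by
  refine LeadingCoeff.of_lift_eq (F := fun z w => lift f z w *
    ((∏ r, rowFun P (j r) w) * ∏ r, rowFun P (k r) (z - w))) (fun z w hm => ?_) fun w hw => ?_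
  · rw [lift_mul, lift_weierstrassProduct i j k hm]
    simp
  · have hk : Tendsto (fun z => ∏ r, rowFun P (k r) (z - w)) (𝓝[≠] 0)
        (𝓝 (∏ r, rowFun P (k r) (-w))) := by
      refine tendsto_finsetProd _ fun r _ => ?_
      have h1 := (analyticAt_rowFun (P := P) (k r) (z := -w) (by simpa using hw)).continuousAt
      have h2 : Tendsto (fun z => z - w) (𝓝[≠] 0) (𝓝 (-w)) := by
        have := ((by fun_prop : Continuous fun z : ℂ => z - w).tendsto 0).mono_left
          (nhdsWithin_le_nhds (s := {0}ᶜ))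
        simpa using this
      exact h1.tendsto.comp h2
    exact ((hf w hw).mul (hk.const_mul _)).congr fun z => by ring

theorem prod_rowFun_neg {n : ℕ} (k : Fin n → Fin 4) (w : ℂ) :
    ∏ r, rowFun P (k r) (-w) = (∏ r, rowSign (k r)) * ∏ r, rowFun P (k r) w := by
  rw [← Finset.prod_mul_distrib]
  exact Finset.prod_congr rfl fun r _ => rowFun_neg P _ _

theorem prod_rowSign_mul_self {n : ℕ} (k : Fin n → Fin 4) :
    (∏ r, rowSign (k r)) * ∏ r, rowSign (k r) = 1 := by
  rw [← Finset.prod_mul_distrib]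
  exact Finset.prod_eq_one fun r _ => rowSign_mul_self _

/-- The leading coefficients are stable under multiplication by products of `℘` and its
derivatives. -/
theorem mul_prod_mem_leadingSpace {a b c b' c' κ : ℕ} {h : ℂ → ℂ}
    (hh : h ∈ leadingSpace P a b c κ) (j : Fin b' → Fin 4) (k : Fin c' → Fin 4) :
    (fun w => h w * ((∏ r, rowFun P (j r) w) * ∏ r, rowFun P (k r) w)) ∈
      leadingSpace P a (b + b') (c + c') κ := by
  obtain ⟨f, hf, hfh⟩ := hh
  have hm : (fun w => h w * ((∏ r, rowFun P (j r) w) * ∏ r, rowFun P (k r) (-w))) ∈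
      leadingSpace P a (b + b') (c + c') κ := by
    have := mul_mem_weierstrassSpan hf (weierstrassProduct_mem P Fin.elim0 j k)
    rw [add_zero] at this
    exact ⟨_, this, hfh.mul_weierstrassProduct _ j k⟩
  refine leadingSpace_congr (Submodule.smul_mem _ (∏ r, rowSign (k r)) hm) fun w _ => ?_
  rw [Pi.smul_apply, smul_eq_mul, prod_rowFun_neg]
  have := prod_rowSign_mul_self k
  generalize (∏ r, rowSign (k r)) = s at *
  linear_combination (-(h w * (∏ r, rowFun P (j r) w) * ∏ r, rowFun P (k r) w)) * this

/-- For `k ≠ 1` a function `ρ(z) φ(w) ψ(z - w)` has a prescribed coefficient of `z⁻ᵏ`. -/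
theorem productSpan_le_leadingSpace {a b c κ : ℕ} (hκ : κ ≤ 4 * a) (h1 : κ ≠ 1) :
    productSpan P (b + c) ≤ leadingSpace P a b c κ := by
  refine Submodule.span_le.2 ?_
  rintro _ ⟨i, rfl⟩
  obtain ⟨ρ, -, d, hd0, hd⟩ := exists_prod_tendsto P a κ hκ h1
  have hone : (fun _ => 1) ∈ leadingSpace P a 0 0 κ := by
    refine ⟨d⁻¹ • weierstrassProduct P ρ Fin.elim0 Fin.elim0,
      Submodule.smul_mem _ _ (weierstrassProduct_mem P _ _ _), ?_⟩
    refine LeadingCoeff.of_lift_eq (F := fun z _ => d⁻¹ * ∏ r, rowFun P (ρ r) z)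
      (fun z w hm => ?_) fun w _ => ?_
    · rw [lift_smul, lift_weierstrassProduct _ _ _ hm]
      simp
    · have := hd.const_mul d⁻¹
      rw [inv_mul_cancel₀ hd0] at this
      exact this.congr fun z => by ring
  have := mul_prod_mem_leadingSpace hone (fun r => i (Fin.castAdd c r)) fun r => i (Fin.natAdd b r)
  simpa [Fin.prod_univ_add] using this

/-- The function `(z, w) ↦ rᵢ(z) rⱼ(w) rₖ(w - z)`, where `r₀, …, r₃ = 1, ℘, ℘', ℘''`. -/
def triple (P : PeriodPair) (i j k : Fin 4) (x : regularLocus P) : ℂ :=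
  row P i x.1.1 * row P j x.1.2 * row P k (x.1.2 - x.1.1)

theorem triple_mem (i j k : Fin 4) : triple P i j k ∈ weierstrassSpan P 1 1 1 := by
  have := Submodule.smul_mem _ (rowSign k) (weierstrassProduct_mem P (fun _ : Fin 1 => i)
    (fun _ : Fin 1 => j) fun _ : Fin 1 => k)
  convert this using 1
  ext x
  simp only [triple, weierstrassProduct, Pi.smul_apply, smul_eq_mul, Finset.univ_unique,
    Finset.prod_singleton]
  rw [← neg_sub x.1.1, row_neg]
  ring

theorem lift_triple (i j k : Fin 4) {z w : ℂ} (h : (proj P z, proj P w) ∈ regularLocus P) :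
    lift (triple P i j k) z w = rowFun P i z * rowFun P j w * rowFun P k (w - z) :=
  lift_of_mem _ h

/-- The derivatives of `1, ℘, ℘', ℘''`. -/
def rowDeriv (P : PeriodPair) (j : Fin 4) (z : ℂ) : ℂ :=
  ![0, P.derivWeierstrassP z, deriv P.derivWeierstrassP z,
    12 * P.weierstrassP z * P.derivWeierstrassP z] j

theorem hasDerivAt_rowFun (j : Fin 4) {z : ℂ} (hz : z ∉ P.lattice) :
    HasDerivAt (rowFun P j) (rowDeriv P j z) z := by
  fin_cases j
  · exact hasDerivAt_const z 1
  · exact hasDerivAt_weierstrassP hz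
  · exact hasDerivAt_derivWeierstrassP hz
  · exact hasDerivAt_deriv_derivWeierstrassP hz

theorem tendsto_slope_rowFun (j : Fin 4) {w : ℂ} (hw : w ∉ P.lattice) :
    Tendsto (fun z => z⁻¹ * (rowFun P j (w - z) - rowFun P j w)) (𝓝[≠] 0)
      (𝓝 (-rowDeriv P j w)) := by
  have h1 : HasDerivAt (fun z => rowFun P j (w - z)) (-rowDeriv P j w) 0 :=
    HasDerivAt.comp_const_sub w 0 (by rw [sub_zero]; exact hasDerivAt_rowFun j hw)
  simpa using h1.tendsto_slope_zero

theorem exists_tendsto_rowFun (P : PeriodPair) (j : Fin 4) :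
    ∃ d ≠ 0, Tendsto (fun z => z ^ rowOrder j * rowFun P j z) (𝓝[≠] 0) (𝓝 d) := by
  obtain ⟨g, hg, hg0, h⟩ := (meromorphicOrderAt_eq_int_iff (meromorphic_rowFun P j 0)).1
    (order_rowFun P j)
  refine ⟨g 0, hg0, (hg.continuousAt.tendsto.mono_left nhdsWithin_le_nhds).congr' ?_⟩
  filter_upwards [h, self_mem_nhdsWithin] with z hz hz0
  have : z ^ rowOrder j ≠ 0 := pow_ne_zero _ hz0
  rw [hz, sub_zero, zpow_neg, zpow_natCast, smul_eq_mul]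
  field_simp

/-- The functions `℘(z) (rⱼ(w) rₖ(w - z) - rₖ(w) rⱼ(w - z))` have simple poles along `{0} × E` with
Wronskians as residues. -/
theorem wronskian_mem_leadingSpace (j k : Fin 4) :
    (fun w => rowFun P k w * rowDeriv P j w - rowFun P j w * rowDeriv P k w) ∈
      leadingSpace P 1 1 1 1 := by
  obtain ⟨d, hd0, hd⟩ := exists_tendsto_rowFun P 1
  refine ⟨d⁻¹ • (triple P 1 j k - triple P 1 k j),
    Submodule.smul_mem _ _ (sub_mem (triple_mem 1 j k) (triple_mem 1 k j)),
    LeadingCoeff.of_lift_eq (F := fun z w => d⁻¹ * (rowFun P 1 z *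
      (rowFun P j w * (rowFun P k (w - z) - rowFun P k w) -
        rowFun P k w * (rowFun P j (w - z) - rowFun P j w)))) (fun z w hm => ?_) fun w hw => ?_⟩
  · rw [lift_smul, lift_sub, lift_triple _ _ _ hm, lift_triple _ _ _ hm]
    ring
  · have h1 := (hd.mul (((tendsto_slope_rowFun k hw).const_mul (rowFun P j w)).sub
      ((tendsto_slope_rowFun j hw).const_mul (rowFun P k w)))).const_mul d⁻¹
    rw [← mul_assoc, inv_mul_cancel₀ hd0] at h1
    convert h1.congr' ?_ using 2
    · ring
    · filter_upwards [self_mem_nhdsWithin] with z hz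
      have hz : z ≠ 0 := hz
      simp only [rowOrder, Matrix.cons_val_one, Matrix.cons_val_zero]
      field_simp

/-- The product of `℘'(z)` with a quadratic expression in the differences `rⱼ(w - z) - rⱼ(w)` has a
simple pole along `{0} × E`. -/
theorem quadric_mem_leadingSpace {f : regularLocus P → ℂ} (hf : f ∈ weierstrassSpan P 1 1 1)
    (α : ℂ) (i j k l : Fin 4) (hlift : ∀ z w, (proj P z, proj P w) ∈ regularLocus P →
      lift f z w = rowFun P 2 z *
        ((rowFun P i (w - z) - rowFun P i w) * (rowFun P j (w - z) - rowFun P j w) -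
          α * ((rowFun P k (w - z) - rowFun P k w) * (rowFun P l (w - z) - rowFun P l w)))) :
    (fun w => rowDeriv P i w * rowDeriv P j w - α * (rowDeriv P k w * rowDeriv P l w)) ∈
      leadingSpace P 1 1 1 1 := by
  obtain ⟨d, hd0, hd⟩ := exists_tendsto_rowFun P 2
  have hlc : LeadingCoeff 1 f fun w =>
      d * (rowDeriv P i w * rowDeriv P j w - α * (rowDeriv P k w * rowDeriv P l w)) := by
    refine LeadingCoeff.of_lift_eq hlift fun w hw => ?_
    have h1 := hd.mul (((tendsto_slope_rowFun i hw).mul (tendsto_slope_rowFun j hw)).sub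
      (((tendsto_slope_rowFun k hw).mul (tendsto_slope_rowFun l hw)).const_mul α))
    convert h1.congr' ?_ using 2
    · ring
    · filter_upwards [self_mem_nhdsWithin] with z hz
      have hz : z ≠ 0 := hz
      have e : rowOrder 2 = 3 := rfl
      simp only [e]
      field_simp
  have hm : (fun w => d * (rowDeriv P i w * rowDeriv P j w - α * (rowDeriv P k w * rowDeriv P l w)))
      ∈ leadingSpace P 1 1 1 1 := ⟨f, hf, hlc⟩
  refine leadingSpace_congr (Submodule.smul_mem _ d⁻¹ hm) fun w _ => ?_
  rw [Pi.smul_apply, smul_eq_mul, inv_mul_cancel_left₀ hd0]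

theorem sub_notMem_of_mem_regularLocus {z w : ℂ} (hm : (proj P z, proj P w) ∈ regularLocus P) :
    w - z ∉ P.lattice := fun h => (mem_regularLocus.1 hm).2.2 (by simpa using neg_mem h)

/-- Up to a constant, the residue of `℘'(z) (℘(w - z) - ℘(w))²`, which lies in `M(4, 4, 4)` because
`℘² = (℘'' + g₂ / 2) / 6`. -/
theorem sq_mem_leadingSpace :
    (fun w => rowDeriv P 1 w * rowDeriv P 1 w) ∈ leadingSpace P 1 1 1 1 := by
  have := quadric_mem_leadingSpace (P := P)
    (f := (1 / 6 : ℂ) • (triple P 2 3 0 + triple P 2 0 3 - (12 : ℂ) • triple P 2 1 1 +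
      P.g₂ • triple P 2 0 0))
    (Submodule.smul_mem _ _ (add_mem (sub_mem (add_mem (triple_mem _ _ _) (triple_mem _ _ _))
      (Submodule.smul_mem _ _ (triple_mem _ _ _))) (Submodule.smul_mem _ _ (triple_mem _ _ _))))
    0 1 1 0 0 fun z w hm => by
      simp only [lift_smul, lift_add, lift_sub, lift_triple _ _ _ hm]
      simp only [rowFun_zero, rowFun_one, rowFun_two, rowFun_three]
      rw [deriv_derivWeierstrassP (mem_regularLocus.1 hm).2.1,
        deriv_derivWeierstrassP (sub_notMem_of_mem_regularLocus hm)]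
      ring
  simpa using this

/-- The quadratic form comes from the Weierstrass equation written as
`℘'² = (2/3) ℘ ℘'' - (2/3) g₂ ℘ - g₃`: its polarization at the arguments `w` and `w - z`,
multiplied by `-2`, is `(Δ℘')² - (2/3) Δ℘ Δ℘''` with `Δφ = φ(w - z) - φ(w)`. -/
theorem sq_sub_mem_leadingSpace :
    (fun w => rowDeriv P 2 w * rowDeriv P 2 w - 2 / 3 * (rowDeriv P 1 w * rowDeriv P 3 w)) ∈
      leadingSpace P 1 1 1 1 :=
  quadric_mem_leadingSpace (P := P)
    (f := (-2 : ℂ) • (triple P 2 2 2 - (1 / 3 : ℂ) • (triple P 2 1 3 + triple P 2 3 1) +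
      (P.g₂ / 3) • (triple P 2 1 0 + triple P 2 0 1) + P.g₃ • triple P 2 0 0))
    (Submodule.smul_mem _ _ (add_mem (add_mem (sub_mem (triple_mem _ _ _)
      (Submodule.smul_mem _ _ (add_mem (triple_mem _ _ _) (triple_mem _ _ _))))
      (Submodule.smul_mem _ _ (add_mem (triple_mem _ _ _) (triple_mem _ _ _))))
      (Submodule.smul_mem _ _ (triple_mem _ _ _))))
    (2 / 3) 2 2 1 3 fun z w hm => by
      simp only [lift_smul, lift_add, lift_sub, lift_triple _ _ _ hm]
      simp only [rowFun_zero, rowFun_one, rowFun_two, rowFun_three]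
      rw [deriv_derivWeierstrassP (mem_regularLocus.1 hm).2.1,
        deriv_derivWeierstrassP (sub_notMem_of_mem_regularLocus hm)]
      have h1 := P.derivWeierstrassP_sq w (mem_regularLocus.1 hm).2.1
      have h2 := P.derivWeierstrassP_sq (w - z) (sub_notMem_of_mem_regularLocus hm)
      linear_combination (-P.derivWeierstrassP z) * (h1 + h2)

/-! ### Residues and the comparison of the two spaces -/

/-- The products of two of the functions `1, ℘, ℘', ℘''`, which span the elliptic functions with a
pole of order at most `8` at the origin, are residues along `{0} × E` of elements of `M(4, 4, 4)`.
Here the non-vanishing of the discriminant is needed. -/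
theorem mul_rowFun_mem_leadingSpace (j k : Fin 4) :
    (fun w => rowFun P j w * rowFun P k w) ∈ leadingSpace P 1 1 1 1 := by
  set R := leadingSpace P 1 1 1 1
  set u := P.weierstrassP
  set v := P.derivWeierstrassP
  set g₂ := P.g₂
  set g₃ := P.g₃
  have hq : ∀ w ∉ P.lattice, deriv v w = 6 * u w ^ 2 - g₂ / 2 := fun w hw =>
    deriv_derivWeierstrassP hw
  have hv2 : ∀ w ∉ P.lattice, v w ^ 2 = 4 * u w ^ 3 - g₂ * u w - g₃ := P.derivWeierstrassP_sq
  have comb : ∀ {h₁ h₂ : ℂ → ℂ} (a b : ℂ), h₁ ∈ R → h₂ ∈ R →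
      (fun w => a * h₁ w + b * h₂ w) ∈ R := fun a b h₁ h₂ =>
    add_mem (Submodule.smul_mem _ a h₁) (Submodule.smul_mem _ b h₂)
  have hw : ∀ j k, (fun w => rowFun P k w * rowDeriv P j w - rowFun P j w * rowDeriv P k w) ∈ R :=
    wronskian_mem_leadingSpace
  have m_v : v ∈ R := leadingSpace_congr (hw 1 0) fun w _ => by simp [rowDeriv, v]
  have m_a : (fun w => 6 * u w ^ 2 - g₂ / 2) ∈ R := leadingSpace_congr (hw 2 0) fun w hwl => by
    simp [rowDeriv, ← hq w hwl, v]
  have m_uv : (fun w => u w * v w) ∈ R :=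
    leadingSpace_congr (Submodule.smul_mem _ (1 / 12 : ℂ) (hw 3 0)) fun w _ => by
      simp [rowDeriv, u, v]; ring
  have m_b : (fun w => 2 * u w ^ 3 + g₂ / 2 * u w + g₃) ∈ R :=
    leadingSpace_congr (hw 2 1) fun w hwl => by
      change _ = u w * deriv v w - v w * v w
      rw [hq w hwl]
      linear_combination hv2 w hwl
  have m_u2v : (fun w => u w ^ 2 * v w) ∈ R :=
    leadingSpace_congr (comb (1 / 6) (-g₂ / 12) (hw 3 1) m_v) fun w hwl => by
      change _ = 1 / 6 * (u w * (12 * u w * v w) - deriv v w * v w) + -g₂ / 12 * v w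
      rw [hq w hwl]
      ring
  have m_c : (fun w => 12 * u w ^ 4 - 6 * g₂ * u w ^ 2 - 12 * g₃ * u w - g₂ ^ 2 / 4) ∈ R :=
    leadingSpace_congr (hw 3 2) fun w hwl => by
      change _ = v w * (12 * u w * v w) - deriv v w * deriv v w
      rw [hq w hwl]
      linear_combination (-12 * u w) * hv2 w hwl
  have m_d : (fun w => 4 * u w ^ 3 - g₂ * u w - g₃) ∈ R :=
    leadingSpace_congr sq_mem_leadingSpace fun w hwl => by
      change _ = v w * v w
      linear_combination -hv2 w hwl
  have m_e : (fun w => 4 * u w ^ 4 + 2 * g₂ * u w ^ 2 + 8 * g₃ * u w + g₂ ^ 2 / 4) ∈ R :=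
    leadingSpace_congr sq_sub_mem_leadingSpace fun w hwl => by
      change _ = deriv v w * deriv v w - 2 / 3 * (v w * (12 * u w * v w))
      rw [hq w hwl]
      linear_combination (8 * u w) * hv2 w hwl
  -- Two combinations are linear in `℘`; their determinant is a multiple of the discriminant.
  have m_x : (fun w => 2 * g₂ * u w + 3 * g₃) ∈ R :=
    leadingSpace_congr (comb 2 (-1) m_b m_d) fun w _ => by ring
  have m_y : (fun w => -36 * g₃ * u w - 2 * g₂ ^ 2) ∈ R :=
    leadingSpace_congr (comb 1 (2 * g₂) (comb 1 (-3) m_c m_e) m_a) fun w _ => by ring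
  obtain ⟨d, hd⟩ : ∃ d, d * (g₂ ^ 3 - 27 * g₃ ^ 2) = 1 :=
    ⟨_, inv_mul_cancel₀ (discriminant_ne_zero P)⟩
  have m_1 : (fun _ => 1) ∈ R :=
    leadingSpace_congr (comb (-9 * g₃ * d) (-(1 / 2) * g₂ * d) m_x m_y) fun w _ => by
      linear_combination -hd
  have m_u : u ∈ R :=
    leadingSpace_congr (comb (1 / 2 * g₂ ^ 2 * d) (3 / 4 * g₃ * d) m_x m_y) fun w _ => by
      linear_combination (-u w) * hd
  have m_u2 : (fun w => u w ^ 2) ∈ R :=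
    leadingSpace_congr (comb (1 / 6) (g₂ / 12) m_a m_1) fun w _ => by ring
  have m_u3 : (fun w => u w ^ 3) ∈ R :=
    leadingSpace_congr (comb 1 (g₃ / 4) (comb (1 / 4) (g₂ / 4) m_d m_u) m_1) fun w _ => by ring
  have m_u4 : (fun w => u w ^ 4) ∈ R :=
    leadingSpace_congr (comb 1 (-g₂ ^ 2 / 16) (comb 1 (-2 * g₃) (comb (1 / 4) (-g₂ / 2) m_e m_u2)
      m_u) m_1) fun w _ => by ring
  have key : ∀ j k : Fin 4, j ≤ k → (fun w => rowFun P j w * rowFun P k w) ∈ R := by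
    intro j k hjk
    fin_cases j <;> fin_cases k <;> first | exact absurd hjk (by decide) | skip
    · exact leadingSpace_congr m_1 fun w _ => one_mul 1
    · exact leadingSpace_congr m_u fun w _ => one_mul (u w)
    · exact leadingSpace_congr m_v fun w _ => one_mul (v w)
    · exact leadingSpace_congr m_a fun w hwl => (one_mul _).trans (hq w hwl)
    · exact leadingSpace_congr m_u2 fun w _ => (sq (u w)).symm
    · exact leadingSpace_congr m_uv fun w _ => rfl
    · refine leadingSpace_congr (comb 6 (-g₂ / 2) m_u3 m_u) fun w hwl => ?_
      change u w * deriv v w = _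
      rw [hq w hwl]
      ring
    · refine leadingSpace_congr m_d fun w hwl => ?_
      change v w * v w = _
      linear_combination hv2 w hwl
    · refine leadingSpace_congr (comb 6 (-g₂ / 2) m_u2v m_v) fun w hwl => ?_
      change v w * deriv v w = _
      rw [hq w hwl]
      ring
    · refine leadingSpace_congr (comb 1 (g₂ ^ 2 / 4) (comb 36 (-6 * g₂) m_u4 m_u2) m_1)
        fun w hwl => ?_
      change deriv v w * deriv v w = _
      rw [hq w hwl]
      ring
  rcases le_total j k with h | h
  · exact key j k h
  · exact leadingSpace_congr (key k j h) fun w _ => mul_comm _ _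

/-- Residues of larger pole order, by multiplying those of elements of `M(4, 4, 4)` with
products that have no pole along `{0} × E`. -/
theorem productSpan_le_leadingSpace_one (a b c : ℕ) :
    productSpan P ((b + 1) + (c + 1)) ≤ leadingSpace P (a + 1) (b + 1) (c + 1) 1 := by
  refine Submodule.span_le.2 ?_
  rintro _ ⟨i, rfl⟩
  obtain ⟨f, hf, hlc⟩ := mul_prod_mem_leadingSpace
    (mul_rowFun_mem_leadingSpace (P := P) (i (Fin.castAdd (c + 1) 0)) (i (Fin.natAdd (b + 1) 0)))
    (fun r : Fin b => i (Fin.castAdd (c + 1) r.succ)) fun r : Fin c => i (Fin.natAdd (b + 1) r.succ)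
  refine ⟨f, weierstrassSpan_mono (by omega) (by omega) (by omega) hf, hlc.congr fun w _ => ?_⟩
  rw [Fin.prod_univ_add, Fin.prod_univ_succ, Fin.prod_univ_succ]
  ring

/-- The induction step on the order `k` of the pole along `{0} × E`. -/
theorem poleSpace_succ_le {a b c k : ℕ} (hk : k + 1 ≤ 4 * a)
    (hlead : productSpan P (b + c) ≤ leadingSpace P a b c (k + 1))
    (ih : poleSpace P k (4 * b) (4 * c) ≤ weierstrassSpan P a b c) :
    poleSpace P (k + 1) (4 * b) (4 * c) ≤ weierstrassSpan P a b c := by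
  intro f hf
  obtain ⟨h, hfh, hh, hha⟩ := HasPolesLE.exists_leadingCoeff hf
  obtain ⟨t, ht, hht⟩ := hh.exists_mem_productSpan (n := b + c) (by omega)
  have hth : ∀ w ∉ P.lattice, t w = h w := fun w hw =>
    tendsto_nhds_unique ((analyticAt_of_mem_productSpan ht hw).continuousAt.tendsto.mono_left
      nhdsWithin_le_nhds)
      (((hha w hw).continuousAt.tendsto.mono_left nhdsWithin_le_nhds).congr' (hht w))
  obtain ⟨f', hf', hf't⟩ := hlead ht
  have hf'p : HasPolesLE P (k + 1) (4 * b) (4 * c) f' :=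
    HasPolesLE.of_leadingCoeff hk (weierstrassSpan_le_poleSpace P a b c hf') hf't
  have hsub : HasPolesLE P (k + 1) (4 * b) (4 * c) (f - f') :=
    (poleSpace P (k + 1) (4 * b) (4 * c)).sub_mem hf hf'p
  have hlow : HasPolesLE P k (4 * b) (4 * c) (f - f') :=
    HasPolesLE.of_leadingCoeff_zero hsub ((hfh.sub hf't).congr fun w hw => by
      rw [Pi.sub_apply, hth w hw, sub_self])
  have := add_mem (ih hlow) hf'
  rwa [sub_add_cancel] at this

/-- If `f` has at most a simple pole along `{0} × E` and no pole along the diagonal, then `f(z, w)`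
does not depend on `z`. -/
theorem HasPolesLE.exists_lift_eq {f : regularLocus P → ℂ} {b : ℕ} (hf : HasPolesLE P 1 b 0 f)
    {w : ℂ} (hw : w ∉ P.lattice) :
    ∃ c, ∀ z, (proj P z, proj P w) ∈ regularLocus P → lift f z w = c := by
  have hloc : ∀ z₀, ∃ g : ℂ → ℂ, AnalyticAt ℂ g z₀ ∧ ∀ᶠ z in 𝓝 z₀,
      (proj P z, proj P w) ∈ regularLocus P → lift f z w * localEq P z₀ z = g z := fun z₀ => by
    obtain ⟨g, hg, h⟩ := hf (z₀, w)
    refine ⟨fun z => g (z, w), AnalyticAt.fun_comp (f := fun z : ℂ => (z, w)) hg (by fun_prop), ?_⟩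
    filter_upwards [((by fun_prop : Continuous fun z : ℂ => (z, w)).tendsto z₀).eventually h]
      with z hz hm
    rw [← hz hm, lift_of_mem f hm]
    simp [divisorEq, localEq_of_notMem hw]
  have hreg : ∀ z₀ ∉ P.lattice, ∃ g : ℂ → ℂ, AnalyticAt ℂ g z₀ ∧
      ∀ᶠ z in 𝓝 z₀, (proj P z, proj P w) ∈ regularLocus P → lift f z w = g z := fun z₀ hz₀ => by
    obtain ⟨g, hg, h⟩ := hloc z₀
    exact ⟨g, hg, by simpa [localEq_of_notMem hz₀] using h⟩
  have hpole : ∀ z₀ ∈ P.lattice, ∃ g : ℂ → ℂ, AnalyticAt ℂ g z₀ ∧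
      ∀ᶠ z in 𝓝[≠] z₀, lift f z w * (z - z₀) ^ 1 = g z := fun z₀ hz₀ => by
    obtain ⟨g, hg, h⟩ := hloc z₀
    refine ⟨g, hg, ?_⟩
    filter_upwards [h.filter_mono nhdsWithin_le_nhds, eventually_mem_regularLocus hw z₀]
      with z hz hm
    rw [pow_one, ← hz hm, localEq_of_mem hz₀]
  have hev : ∀ z₀ ∉ P.lattice, ∃ g : ℂ → ℂ, AnalyticAt ℂ g z₀ ∧
      (fun z => lift f z w) =ᶠ[𝓝[≠] z₀] g := fun z₀ hz₀ => by
    obtain ⟨g, hg, h⟩ := hreg z₀ hz₀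
    refine ⟨g, hg, ?_⟩
    filter_upwards [h.filter_mono nhdsWithin_le_nhds, eventually_mem_regularLocus hw z₀]
      with z hz hm using hz hm
  have hm : Meromorphic fun z => lift f z w := fun z₀ => by
    by_cases hz₀ : z₀ ∈ P.lattice
    · obtain ⟨g, hg, h⟩ := hpole z₀ hz₀
      exact meromorphicAt_of_mul_pow hg h
    · obtain ⟨g, hg, h⟩ := hev z₀ hz₀
      exact hg.meromorphicAt.congr h.symm
  have hP : PoleLE P 1 fun z => lift f z w :=
    ⟨hm, fun l hl z => lift_add_left f hl z w, fun z₀ hz₀ => by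
      obtain ⟨g, hg, h⟩ := hev z₀ hz₀
      rw [meromorphicOrderAt_congr h]
      exact hg.meromorphicOrderAt_nonneg,
    (neg_natCast_le_order_iff (hm 0) 1).2 (hpole 0 (zero_mem _))⟩
  obtain ⟨c, hc⟩ := hP.exists_eq_const
  refine ⟨c, fun z hz => ?_⟩
  obtain ⟨g, hg, h⟩ := hreg z (mem_regularLocus.1 hz).1
  rw [h.self_of_nhds hz]
  refine tendsto_nhds_unique (hg.continuousAt.tendsto.mono_left (nhdsWithin_le_nhds (s := {z}ᶜ)))
    (tendsto_const_nhds.congr' ?_)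
  filter_upwards [hc z, h.filter_mono nhdsWithin_le_nhds, eventually_mem_regularLocus hw z]
    with y h1 h2 hm
  rw [← h2 hm, h1]

/-- The same with the constants collected into a function of `w`, which is then the leading
coefficient of order `0`. -/
theorem HasPolesLE.exists_lift_eq_const {f : regularLocus P → ℂ} {b : ℕ} (hf : HasPolesLE P 1 b 0 f) :
    ∃ h, LeadingCoeff 0 f h ∧
      ∀ z w, (proj P z, proj P w) ∈ regularLocus P → lift f z w = h w := by
  have : ∀ w, ∃ c, w ∉ P.lattice →
      ∀ z, (proj P z, proj P w) ∈ regularLocus P → lift f z w = c := fun w => by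
    by_cases hw : w ∈ P.lattice
    · exact ⟨0, fun h => absurd hw h⟩
    · obtain ⟨c, hc⟩ := hf.exists_lift_eq hw
      exact ⟨c, fun _ => hc⟩
  choose h hh using this
  have key : ∀ z w, (proj P z, proj P w) ∈ regularLocus P → lift f z w = h w := fun z w hm =>
    hh w (mem_regularLocus.1 hm).2.1 z hm
  exact ⟨h, LeadingCoeff.of_lift_eq key fun w _ => by simp, key⟩

theorem eq_zero_of_leadingCoeff_zero {f : regularLocus P → ℂ} {b : ℕ}
    (hf : HasPolesLE P 1 b 0 f) (h0 : LeadingCoeff 0 f fun _ => 0) : f = 0 := by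
  obtain ⟨h, hfh, hh⟩ := HasPolesLE.exists_lift_eq_const hf
  ext ⟨⟨x, y⟩, hm⟩
  obtain ⟨z, rfl⟩ := Submodule.Quotient.mk_surjective _ x
  obtain ⟨w, rfl⟩ := Submodule.Quotient.mk_surjective _ y
  have hw := (mem_regularLocus.1 hm).2.1
  have := hh z w hm
  rw [lift_of_mem f hm] at this
  exact this.trans (tendsto_nhds_unique (hfh w hw) (h0 w hw))

/-- The case in which there is no pole along the diagonal and at most a simple one along
`{0} × E`. -/
theorem poleSpace_one_le (b : ℕ) : poleSpace P 1 (4 * b) 0 ≤ weierstrassSpan P 0 b 0 := by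
  intro f hf
  have hf1 : HasPolesLE P 1 (4 * b) 0 f := hf
  obtain ⟨h₀, hfh₀, -⟩ := HasPolesLE.exists_lift_eq_const hf1
  have hf0 : HasPolesLE P 0 (4 * b) 0 f := hf1.of_leadingCoeff_zero hfh₀.mono
  obtain ⟨h, hfh, hh, hha⟩ := hf0.exists_leadingCoeff
  obtain ⟨t, ht, hht⟩ := hh.exists_mem_productSpan (n := b + 0) (by omega)
  have hth : ∀ w ∉ P.lattice, t w = h w := fun w hw =>
    tendsto_nhds_unique ((analyticAt_of_mem_productSpan ht hw).continuousAt.tendsto.mono_left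
      nhdsWithin_le_nhds)
      (((hha w hw).continuousAt.tendsto.mono_left nhdsWithin_le_nhds).congr' (hht w))
  obtain ⟨f', hf', hf't⟩ := productSpan_le_leadingSpace (a := 0) (κ := 0) le_rfl zero_ne_one ht
  have hf'1 : HasPolesLE P 1 (4 * b) 0 f' :=
    HasPolesLE.mono_left (Nat.zero_le 1) (weierstrassSpan_le_poleSpace P 0 b 0 hf')
  have hsub : HasPolesLE P 1 (4 * b) 0 (f - f') :=
    (poleSpace P 1 (4 * b) 0).sub_mem hf hf'1
  have := eq_zero_of_leadingCoeff_zero hsub ((hfh.sub hf't).congr fun w hw => by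
    rw [Pi.sub_apply, hth w hw, sub_self])
  rwa [sub_eq_zero.1 this]

theorem poleSpace_le_of_diag_zero {a b k : ℕ} (hk : k ≤ 4 * a) :
    poleSpace P k (4 * b) (4 * 0) ≤ weierstrassSpan P a b 0 := by
  have hsmall : ∀ k ≤ 1, poleSpace P k (4 * b) (4 * 0) ≤ weierstrassSpan P a b 0 :=
    fun k hk1 f hf => weierstrassSpan_mono (Nat.zero_le a) le_rfl le_rfl
      (poleSpace_one_le b (HasPolesLE.mono_left hk1 hf))
  induction k with
  | zero => exact hsmall 0 zero_le_one
  | succ k ih =>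
    by_cases h0 : k = 0
    · subst h0
      exact hsmall 1 le_rfl
    · exact poleSpace_succ_le hk (productSpan_le_leadingSpace hk (by omega)) (ih (by omega))

/-- The start of the induction, obtained from the case `c = 0` by exchanging `{0} × E` with the
diagonal. -/
theorem poleSpace_zero_le (b c : ℕ) :
    poleSpace P 0 (4 * b) (4 * c) ≤ weierstrassSpan P 0 b c := by
  intro f hf
  have h1 : f ∘ swapDiag ∈ weierstrassSpan P c b 0 :=
    poleSpace_le_of_diag_zero le_rfl (HasPolesLE.comp_swapDiag hf)
  have h2 := comp_swapDiag_mem h1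
  rwa [show (f ∘ swapDiag) ∘ swapDiag = f from
    funext fun x => congrArg f (swapDiag_swapDiag x)] at h2

theorem poleSpace_le_weierstrassSpan (a b c : ℕ) :
    poleSpace P (4 * a) (4 * b) (4 * c) ≤ weierstrassSpan P a b c := by
  rcases Nat.eq_zero_or_pos c with rfl | hc
  · exact poleSpace_le_of_diag_zero le_rfl
  rcases Nat.eq_zero_or_pos b with rfl | hb
  · intro f hf
    have h1 : f ∘ swapSnd ∈ weierstrassSpan P a c 0 :=
      poleSpace_le_of_diag_zero le_rfl (HasPolesLE.comp_swapSnd hf)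
    have h2 := comp_swapSnd_mem h1
    rwa [show (f ∘ swapSnd) ∘ swapSnd = f from
      funext fun x => congrArg f (swapSnd_swapSnd x)] at h2
  obtain ⟨b, rfl⟩ := Nat.exists_eq_succ_of_ne_zero hb.ne'
  obtain ⟨c, rfl⟩ := Nat.exists_eq_succ_of_ne_zero hc.ne'
  suffices ∀ k ≤ 4 * a, poleSpace P k (4 * (b + 1)) (4 * (c + 1)) ≤
      weierstrassSpan P a (b + 1) (c + 1) from this _ le_rfl
  intro k hk
  induction k with
  | zero => exact (poleSpace_zero_le _ _).trans (weierstrassSpan_mono (Nat.zero_le a) le_rfl le_rfl)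
  | succ k ih =>
    refine poleSpace_succ_le hk ?_ (ih (by omega))
    by_cases h0 : k = 0
    · subst h0
      obtain ⟨a, rfl⟩ : ∃ a', a = a' + 1 := ⟨a - 1, by omega⟩
      exact productSpan_le_leadingSpace_one a b c
    · exact productSpan_le_leadingSpace hk (by omega)

end EllipticSquare

end

theorem proposition6p5 (P : PeriodPair) (a b c : ℕ) :
    Function.Surjective (EllipticSquare.mulMap P a b c) ∧
      EllipticSquare.poleSpace P (4 * a) (4 * b) (4 * c) =
        EllipticSquare.weierstrassSpan P a b c := by
  refine ⟨fun f => ?_, le_antisymm (EllipticSquare.poleSpace_le_weierstrassSpan a b c)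
    (EllipticSquare.weierstrassSpan_le_poleSpace P a b c)⟩
  obtain ⟨t, ht⟩ := EllipticSquare.weierstrassSpan_le_range P a b c
    (EllipticSquare.poleSpace_le_weierstrassSpan a b c f.2)
  exact ⟨t, Subtype.ext ht⟩
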